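/- **Setting.** Let $d\ge 1$, $m\ge 2$, $M=2^m$. Consider the convection equation $\partial_t u+\sum_{l=1}^d\partial_{x_l}u=0$ on $(-1,1)^d$ with periodic boundary conditions. With an auxiliary variable $p\in[-\pi,\pi]$ put $w=\sin(p)\,u$, so that $\partial_t w-\sum_{l}\partial_{x_l}\partial_{pp}w=0$. Discretise each of the $d+1$ directions $x_1,\dots,x_d,p$ by the Fourier spectral method with $M$ equidistant points ($m$ qubits per direction): on an interval $[a,b]$ let $x_j=a+j(b-a)/M$, $\mu_l=2\pi(l-M/2)/(b-a)$ for $0\le j,l<M$, $\Phi=(e^{\mathrm i\mu_l(x_j-a)})_{jl}$, $D_\mu=\mathrm{diag}(\mu_l)$, $P_\mu=\Phi D_\mu\Phi^{-1}$. Write $\boldsymbol P_l$, $\boldsymbol D_l^\mu$ for $P_\mu$, $D_\mu$ acting on the $l$-th of the $d$ $x$-registers. The vector $\boldsymbol w(t)$ of grid values then satisfies, for $t\ge 0$, $$\boldsymbol w'(t)+\mathrm i\sum_{l=1}^d(\boldsymbol P_l\otimes P_\mu^2)\,\boldsymbol w(t)=0 .\qquad(*)$$ Let $\boldsymbol H=\sum_{l=1}^d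 \boldsymbol D_l^\mu\otimes D_\mu^2$ (a diagonal matrix) and let $F=(M^{-1/2}\Phi)^{\otimes(d+1)}$ be the (unitary) quantum Fourier transform on all $d+1$ registers. A gate is an arbitrary unitary acting on at most two of the $(d+1)m$ qubits; no ancillas are used. Norms are Euclidean norms and the induced operator norms. **Theorem 2.2.** For every $k\in\mathbb N$ there is a constant $K>0$, depending only on $k$, such that for all $d\ge1$, $m\ge2$ and $t\ge0$ there are circuits $C_{\rm in}$, $C_{\rm diag}$, $C_{\rm out}$ on $(d+1)m$ qubits with altogether $$N_{\rm Gates}\le K\,(d+1)\,m\log m$$ gates, such that: 1. $C_{\rm in}$ is an inverse QFT and $C_{\rm out}$ is a QFT up to error $(d+1)m^{-k}$, i.e. $\|C_{\rm in}-F^{-1}\|\le (d+1)m^{-k}$ and $\|C_{\rm out}-F\|\le (d+1)m^{-k}$, and $C_{\rm diag}$ is a diagonal unitary. 2. Every solution of $(*)$ satisfies $\boldsymbol w(t)=F\,e^{-\mathrm i\boldsymbol Ht}\,F^{-1}\boldsymbol w(0)$. 3. For every grid function $\boldsymbol u^0\in\mathbb C^{M^d}$, the solution $\boldsymbol w$ of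 $(*)$ whose initial value has the entries $\sin(p_q)\,\boldsymbol u^0_{\boldsymbol j}$ is simulated: $C_{\rm diag}F^{-1}\boldsymbol w(0)=e^{-\mathrm i\boldsymbol Ht}F^{-1}\boldsymbol w(0)$ and $$\|C_{\rm out}C_{\rm diag}C_{\rm in}\boldsymbol w(0)-\boldsymbol w(t)\|\le (d+1)\,m^{-k}\,\|\boldsymbol w(0)\| .$$ 4. If moreover $\boldsymbol u^0_{\boldsymbol j}=u(0,x_{\boldsymbol j})$ for a classical solution $u$ of the convection equation whose initial value is a linear combination of the basis functions $\prod_{i=1}^d e^{\mathrm i\mu_{l_i}(x_i+1)}$, $0\le l_i<M$, then $\boldsymbol w(t)$ has the entries $\sin(p_q)\,u(t,x_{\boldsymbol j})$. -/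

import Mathlib

noncomputable section

/-! ### Quantum circuits with one- and two-qubit gates -/

/-- A quantum gate on the qubits labelled by `Q`: an arbitrary unitary acting on two distinct
qubits (a one-qubit gate is the special case of a unitary that is trivial on one of them). -/
structure TwoQubitGate (Q : Type) where
  q₁ : Q
  q₂ : Q
  ne : q₁ ≠ q₂
  U : Matrix.unitaryGroup (Fin 2 × Fin 2) ℂ

/-- The matrix of a gate on the whole space, in the computational basis `Q → Fin 2`:
the gate acts on `q₁, q₂` and is the identity on all other qubits. -/
def TwoQubitGate.toMatrix {Q : Type} [Fintype Q] [DecidableEq Q] (g : TwoQubitGate Q) :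
    Matrix (Q → Fin 2) (Q → Fin 2) ℂ :=
  Matrix.of fun s s' =>
    if ∀ q, q ≠ g.q₁ → q ≠ g.q₂ → s q = s' q then
      g.U.1 (s g.q₁, s g.q₂) (s' g.q₁, s' g.q₂)
    else 0

/-- A circuit is a finite sequence of gates, the head being applied first.
Its gate count is the length of the list. -/
abbrev Circuit (Q : Type) := List (TwoQubitGate Q)

/-- The operator implemented by a circuit. -/
def Circuit.toMatrix {Q : Type} [Fintype Q] [DecidableEq Q] :
    Circuit Q → Matrix (Q → Fin 2) (Q → Fin 2) ℂ
  | [] => 1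
  | g :: C => Circuit.toMatrix C * g.toMatrix

/-! ### One-dimensional Fourier spectral discretisation with `M = 2 ^ m` points on `[a, b]` -/

/-- The grid points `a + j (b - a) / M`, `j = 0, …, M - 1`. -/
def node (a b : ℝ) (m : ℕ) (j : Fin (2 ^ m)) : ℝ := a + (j : ℕ) * ((b - a) / 2 ^ m)

/-- The wave numbers `2 π (l - M / 2) / (b - a)`, `l = 0, …, M - 1`. -/
def waveNumber (a b : ℝ) (m : ℕ) (l : Fin (2 ^ m)) : ℝ :=
  2 * Real.pi * (((l : ℕ) : ℝ) - 2 ^ m / 2) / (b - a)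

/-- The basis functions `φ_l(x) = exp (i μ_l (x - a))`. -/
def specBasis (a b : ℝ) (m : ℕ) (l : Fin (2 ^ m)) (x : ℝ) : ℂ :=
  Complex.exp (Complex.I * ((waveNumber a b m l * (x - a) : ℝ) : ℂ))

/-- The transformation matrix `Φ = (φ_l(x_j))`, from coefficients to grid values. -/
def Phi (a b : ℝ) (m : ℕ) : Matrix (Fin (2 ^ m)) (Fin (2 ^ m)) ℂ :=
  Matrix.of fun j l => specBasis a b m l (node a b m j)

/-- The momentum operator in momentum space, `D_μ = diag (μ_l)`. -/
def Dmu (a b : ℝ) (m : ℕ) : Matrix (Fin (2 ^ m)) (Fin (2 ^ m)) ℂ :=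
  Matrix.diagonal fun l => (waveNumber a b m l : ℂ)

/-- The momentum operator in position space, `P_μ = Φ D_μ Φ⁻¹`. -/
def Pmu (a b : ℝ) (m : ℕ) : Matrix (Fin (2 ^ m)) (Fin (2 ^ m)) ℂ :=
  Phi a b m * Dmu a b m * (Phi a b m)⁻¹

/-! ### Tensor grid in the `d + 1` directions `x_1, …, x_d, p`

Direction `Fin.castSucc l` is `x_l ∈ [-1, 1]`, direction `Fin.last d` is `p ∈ [-π, π]`. -/

/-- Multi-indices of the grid; these label the computational basis. -/
abbrev Grid (d m : ℕ) := Fin (d + 1) → Fin (2 ^ m)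

/-- `m` qubits for each of the `d + 1` directions. -/
abbrev Qubits (d m : ℕ) := Fin (d + 1) × Fin m

/-- Binary encoding of the grid indices, direction by direction. -/
def gridEquiv (d m : ℕ) : (Qubits d m → Fin 2) ≃ Grid d m :=
  (Equiv.curry (Fin (d + 1)) (Fin m) (Fin 2)).trans
    (Equiv.piCongrRight fun _ => finFunctionFinEquiv)

/-- The operator of a circuit, in the basis of grid multi-indices. -/
def circuitOp {d m : ℕ} (C : Circuit (Qubits d m)) : Matrix (Grid d m) (Grid d m) ℂ :=
  Matrix.reindex (gridEquiv d m) (gridEquiv d m) (Circuit.toMatrix C)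

/-- Left end point of the interval in direction `r`. -/
def lo {d : ℕ} (r : Fin (d + 1)) : ℝ := if r = Fin.last d then -Real.pi else -1

/-- Right end point of the interval in direction `r`. -/
def hi {d : ℕ} (r : Fin (d + 1)) : ℝ := if r = Fin.last d then Real.pi else 1

/-- The tensor product `A_1 ⊗ ⋯ ⊗ A_{d+1}`. -/
def tensorOp {d m : ℕ} (A : Fin (d + 1) → Matrix (Fin (2 ^ m)) (Fin (2 ^ m)) ℂ) :
    Matrix (Grid d m) (Grid d m) ℂ :=
  Matrix.of fun j l => ∏ r, A r (j r) (l r)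

/-- The quantum Fourier transform on all `d + 1` registers: `F_x ⊗ F_p = Φ ⊗ ⋯ ⊗ Φ`, each
factor normalised by `1 / √M` so as to be unitary. -/
def qft (d m : ℕ) : Matrix (Grid d m) (Grid d m) ℂ :=
  tensorOp fun r => ((1 / Real.sqrt (2 ^ m) : ℝ) : ℂ) • Phi (lo r) (hi r) m

/-- `∑_l P_l ⊗ P_μ ^ 2`, the Hamiltonian in position space. -/
def hamP (d m : ℕ) : Matrix (Grid d m) (Grid d m) ℂ :=
  ∑ l : Fin d, tensorOp fun r =>
    if r = Fin.castSucc l then Pmu (lo r) (hi r) m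
    else if r = Fin.last d then Pmu (lo r) (hi r) m ^ 2
    else 1

/-- `∑_l D_l ⊗ D_μ ^ 2`, the (diagonal) Hamiltonian in momentum space. -/
def hamD (d m : ℕ) : Matrix (Grid d m) (Grid d m) ℂ :=
  ∑ l : Fin d, tensorOp fun r =>
    if r = Fin.castSucc l then Dmu (lo r) (hi r) m
    else if r = Fin.last d then Dmu (lo r) (hi r) m ^ 2
    else 1

/-- The diagonal unitary `exp (-i t ∑_l D_l ⊗ D_μ ^ 2)`. -/
def diagEvolution (d m : ℕ) (t : ℝ) : Matrix (Grid d m) (Grid d m) ℂ :=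
  NormedSpace.exp ((-Complex.I * (t : ℂ)) • hamD d m)

/-- `w` solves, for `t ≥ 0`, the Schrödingerised convection equation
`∂_t w - ∑_l ∂_{x_l} ∂_{pp} w = 0` after Fourier spectral discretisation in all variables:
`w' + i (∑_l P_l ⊗ P_μ ^ 2) w = 0`. -/
def IsSchrodingerisedSolution (d m : ℕ) (w : ℝ → Grid d m → ℂ) : Prop :=
  ∀ t : ℝ, 0 ≤ t →
    HasDerivWithinAt w (-(Complex.I • (hamP d m).mulVec (w t))) (Set.Ici 0) t

/-- The point of `[-1, 1] ^ d` with multi-index `j`. -/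
def xPoint (d m : ℕ) (j : Fin d → Fin (2 ^ m)) : Fin d → ℝ := fun i => node (-1) 1 m (j i)

/-- The grid values of `sin (p) u(x)`, from the grid values of `u`. -/
def sinLift {d m : ℕ} (u : (Fin d → Fin (2 ^ m)) → ℂ) : Grid d m → ℂ :=
  fun j => (Real.sin (node (-Real.pi) Real.pi m (j (Fin.last d))) : ℂ) *
    u (fun i => j (Fin.castSucc i))

/-- `u` is a classical solution, for `t ≥ 0`, of `∂_t u + ∑_l ∂_{x_l} u = 0` with periodic
boundary conditions on `(-1, 1) ^ d` (as a function on `ℝ ^ d` of period `2` in each variable). -/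
def IsConvectionSolution (d : ℕ) (u : ℝ → (Fin d → ℝ) → ℂ) : Prop :=
  DifferentiableOn ℝ (fun y : ℝ × (Fin d → ℝ) => u y.1 y.2) (Set.Ici 0 ×ˢ Set.univ) ∧
  (∀ t : ℝ, 0 ≤ t → ∀ x : Fin d → ℝ, ∀ l : Fin d,
    u t (Function.update x l (x l + 2)) = u t x) ∧
  (∀ t : ℝ, 0 ≤ t → ∀ x : Fin d → ℝ,
    derivWithin (fun s => u s x) (Set.Ici 0) t +
      ∑ l : Fin d, deriv (fun s => u t (Function.update x l s)) (x l) = 0)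

/-- `f` belongs to the `d`-dimensional Fourier spectral space,
`f(x) = ∑_l c_l φ_{l_1}(x_1) ⋯ φ_{l_d}(x_d)`. -/
def InSpectralSpace (d m : ℕ) (f : (Fin d → ℝ) → ℂ) : Prop :=
  ∃ c : (Fin d → Fin (2 ^ m)) → ℂ, ∀ x : Fin d → ℝ,
    f x = ∑ l, c l * ∏ i, specBasis (-1) 1 m (l i) (x i)

/-- Euclidean norm of a state vector. -/
def stateNorm {d m : ℕ} (v : Grid d m → ℂ) : ℝ := ‖WithLp.toLp 2 v‖

/-- Operator norm with respect to the Euclidean norm. -/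
def opNorm {d m : ℕ} (A : Matrix (Grid d m) (Grid d m) ℂ) : ℝ :=
  ‖Matrix.toEuclideanCLM (n := Grid d m) (𝕜 := ℂ) A‖

end

/-! The proof has four ingredients.

Fourier circuits. The normalised Fourier matrix of a register does not depend on the interval.
Entrywise it is a product over the qubits of a Hadamard factor and phases that couple an output bit
with less significant input bits (`scaled_Phi_apply`). If significant qubits are treated first, the
controls still hold input bits, so one-qubit gates, controlled phases and a bit reversal give the
QFT exactly (`permute_layered_apply`). The angles decay geometrically with the distance of the two
qubits. Keeping distances at most `b`, of order `log m`, leaves `O(m log m)` gates per register at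
polynomially small error (`exists_circuit_qft_log`). The inverse QFT is the reversed circuit.

Diagonalisation. The identity `P Φ = Φ D`, tensored over the registers, turns the system into
independent scalar equations for the Fourier coefficients (`hamP_mul_qft`,
`IsSchrodingerisedSolution.eq_evolution`).

The cheap diagonal. The full evolution has phases `(∑ μ_l) μ_p ^ 2`, which couple qubits of
different registers. But `sin p` contains only the momenta `±1`, where `μ_p ^ 2 = 1`
(`waveNumber_sq_mul_coeff`). On such data the phase is `∑ μ_l`, which is affine in the bits, so
one-qubit phase gates suffice (`exists_circuit_diagonal_evolution`). The circuit equals the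
evolution on the data, not as an operator, and adds no error.

Exactness. Convection solutions are constant along characteristics, so trigonometric data evolve by
phases on each mode. Multiplied by `sin p`, these modes solve the discrete system, and the evolution
formula gives uniqueness (`IsSchrodingerisedSolution.eq_sinLift`). -/

section

open Matrix Complex

/-! ### Algebra of gates and circuits -/

section Gates

variable {Q : Type} [Fintype Q] [DecidableEq Q]

/-- The extension of a two-qubit operator by the identity on all other qubits. -/
def pairMatrix (q₁ q₂ : Q) (A : Matrix (Fin 2 × Fin 2) (Fin 2 × Fin 2) ℂ) :
    Matrix (Q → Fin 2) (Q → Fin 2) ℂ :=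
  Matrix.of fun s s' =>
    if ∀ q, q ≠ q₁ → q ≠ q₂ → s q = s' q then A (s q₁, s q₂) (s' q₁, s' q₂) else 0

/-- The extension of a one-qubit operator by the identity on all other qubits. -/
def singleMatrix (q : Q) (A : Matrix (Fin 2) (Fin 2) ℂ) : Matrix (Q → Fin 2) (Q → Fin 2) ℂ :=
  Matrix.of fun s s' => if ∀ r, r ≠ q → s r = s' r then A (s q) (s' q) else 0

/-- The action of a permutation of the qubits. -/
def permuteMatrix (σ : Equiv.Perm Q) : Matrix (Q → Fin 2) (Q → Fin 2) ℂ :=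
  Matrix.of fun s s' => if s' = s ∘ σ then 1 else 0

/-- A row of a two-qubit operator is supported on the four strings that differ from `s` at most at
the two qubits. This reduces matrix products to `4 × 4` ones. -/
theorem sum_ite_eq_off_pair {q₁ q₂ : Q} (h : q₁ ≠ q₂) (s : Q → Fin 2)
    (f : (Q → Fin 2) → ℂ) :
    ∑ s', (if ∀ q, q ≠ q₁ → q ≠ q₂ → s q = s' q then f s' else 0) =
      ∑ x : Fin 2 × Fin 2, f (Function.update (Function.update s q₁ x.1) q₂ x.2) := by
  symm
  apply Fintype.sum_of_injective
    (fun x : Fin 2 × Fin 2 => Function.update (Function.update s q₁ x.1) q₂ x.2)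
  · rintro ⟨a, b⟩ ⟨c, e⟩ hab
    have h1 := congrFun hab q₁
    have h2 := congrFun hab q₂
    simp [Function.update_of_ne h] at h1 h2
    simp [h1, h2]
  · intro s' hs'
    rw [if_neg]
    intro hag
    apply hs'
    refine ⟨(s' q₁, s' q₂), ?_⟩
    funext q
    by_cases h2 : q = q₂
    · subst h2; simp
    · by_cases h1 : q = q₁
      · subst h1; simp [h2]
      · simp [h1, h2, hag q h1 h2]
  · rintro ⟨a, b⟩
    rw [if_pos]
    intro q h1 h2
    simp [h1, h2]

theorem sum_ite_eq_off (q : Q) (s : Q → Fin 2) (f : (Q → Fin 2) → ℂ) :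
    ∑ s', (if ∀ r, r ≠ q → s r = s' r then f s' else 0) =
      ∑ x : Fin 2, f (Function.update s q x) := by
  symm
  apply Fintype.sum_of_injective (fun x : Fin 2 => Function.update s q x)
  · exact Function.update_injective s q
  · intro s' hs'
    rw [if_neg]
    intro hag
    apply hs'
    refine ⟨s' q, ?_⟩
    funext r
    by_cases h1 : r = q
    · subst h1; simp
    · simp [h1, hag r h1]
  · intro a
    rw [if_pos]
    intro r h1
    simp [h1]

theorem pairMatrix_mul {q₁ q₂ : Q} (h : q₁ ≠ q₂) (A B : Matrix (Fin 2 × Fin 2) (Fin 2 × Fin 2) ℂ) :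
    pairMatrix q₁ q₂ A * pairMatrix q₁ q₂ B = pairMatrix q₁ q₂ (A * B) := by
  ext s s'
  simp only [Matrix.mul_apply, pairMatrix, Matrix.of_apply, ite_mul, zero_mul]
  rw [sum_ite_eq_off_pair h]
  have hiff : ∀ x : Fin 2 × Fin 2, (∀ q, q ≠ q₁ → q ≠ q₂ →
      Function.update (Function.update s q₁ x.1) q₂ x.2 q = s' q) ↔
      ∀ q, q ≠ q₁ → q ≠ q₂ → s q = s' q := by
    intro x
    refine forall_congr' fun q => forall_congr' fun h1 => forall_congr' fun h2 => ?_
    simp [h1, h2]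
  simp only [hiff]
  split_ifs with hs
  · refine Finset.sum_congr rfl fun x _ => ?_
    simp [Function.update_of_ne h]
  · simp

theorem pairMatrix_one (q₁ q₂ : Q) : pairMatrix q₁ q₂ 1 = 1 := by
  ext s s'
  simp only [pairMatrix, Matrix.of_apply, Matrix.one_apply, Prod.mk.injEq]
  by_cases hs : s = s'
  · subst hs; simp
  · rw [if_neg hs]
    split_ifs with h1 h2
    · exfalso
      apply hs
      funext q
      by_cases e1 : q = q₁
      · rw [e1]; exact h2.1
      · by_cases e2 : q = q₂
        · rw [e2]; exact h2.2
        · exact h1 q e1 e2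
    · rfl
    · rfl

theorem pairMatrix_conjTranspose (q₁ q₂ : Q) (A : Matrix (Fin 2 × Fin 2) (Fin 2 × Fin 2) ℂ) :
    (pairMatrix q₁ q₂ A)ᴴ = pairMatrix q₁ q₂ Aᴴ := by
  ext s s'
  simp only [Matrix.conjTranspose_apply, pairMatrix, Matrix.of_apply]
  have : (∀ q, q ≠ q₁ → q ≠ q₂ → s' q = s q) ↔ ∀ q, q ≠ q₁ → q ≠ q₂ → s q = s' q := by
    simp only [eq_comm]
  simp only [this]
  split_ifs <;> simp

namespace TwoQubitGate

theorem toMatrix_eq (g : TwoQubitGate Q) : g.toMatrix = pairMatrix g.q₁ g.q₂ g.U.1 := rfl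

/-- The inverse gate. -/
def inverse (g : TwoQubitGate Q) : TwoQubitGate Q := ⟨g.q₁, g.q₂, g.ne, g.U⁻¹⟩

theorem inverse_toMatrix (g : TwoQubitGate Q) : g.inverse.toMatrix = g.toMatrixᴴ := by
  rw [toMatrix_eq, toMatrix_eq, pairMatrix_conjTranspose]; rfl

theorem toMatrix_mem_unitaryGroup (g : TwoQubitGate Q) :
    g.toMatrix ∈ Matrix.unitaryGroup (Q → Fin 2) ℂ := by
  rw [Matrix.mem_unitaryGroup_iff, Matrix.star_eq_conjTranspose, toMatrix_eq,
    pairMatrix_conjTranspose, pairMatrix_mul g.ne, ← Matrix.star_eq_conjTranspose,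
    Matrix.mem_unitaryGroup_iff.mp g.U.2, pairMatrix_one]

end TwoQubitGate

namespace Circuit

theorem toMatrix_append (C C' : Circuit Q) :
    Circuit.toMatrix (C ++ C') = Circuit.toMatrix C' * Circuit.toMatrix C := by
  induction C with
  | nil => simp [Circuit.toMatrix]
  | cons g C ih => simp [Circuit.toMatrix, ih, Matrix.mul_assoc]

theorem toMatrix_singleton (g : TwoQubitGate Q) : Circuit.toMatrix [g] = g.toMatrix := by
  simp [Circuit.toMatrix]

theorem toMatrix_mem_unitaryGroup (C : Circuit Q) :
    Circuit.toMatrix C ∈ Matrix.unitaryGroup (Q → Fin 2) ℂ := by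
  induction C with
  | nil => exact one_mem _
  | cons g C ih => exact mul_mem ih g.toMatrix_mem_unitaryGroup

/-- The inverse gates in reverse order. -/
def inverse (C : Circuit Q) : Circuit Q := (C.map TwoQubitGate.inverse).reverse

omit [Fintype Q] [DecidableEq Q] in
theorem length_inverse (C : Circuit Q) : (inverse C).length = C.length := by simp [inverse]

theorem inverse_toMatrix (C : Circuit Q) :
    Circuit.toMatrix (inverse C) = (Circuit.toMatrix C)ᴴ := by
  induction C with
  | nil => simp [inverse, Circuit.toMatrix]
  | cons g C ih =>
    have : inverse (g :: C) = inverse C ++ [g.inverse] := by simp [inverse]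
    rw [this, toMatrix_append, toMatrix_singleton, ih, Circuit.toMatrix,
      Matrix.conjTranspose_mul, g.inverse_toMatrix]

end Circuit

/-- A gate always names two distinct qubits, so a spare qubit `r` is needed; the gate is `A ⊗ 1` on
`q, r`. -/
theorem exists_gate_singleMatrix [Nontrivial Q] (q : Q) {A : Matrix (Fin 2) (Fin 2) ℂ}
    (hA : A ∈ Matrix.unitaryGroup (Fin 2) ℂ) :
    ∃ g : TwoQubitGate Q, g.toMatrix = singleMatrix q A := by
  obtain ⟨r, hr⟩ := exists_ne q
  refine ⟨⟨q, r, hr.symm, ⟨_, Matrix.kronecker_mem_unitary hA (one_mem _)⟩⟩, ?_⟩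
  ext s s'
  simp only [TwoQubitGate.toMatrix, singleMatrix, Matrix.of_apply, Matrix.kroneckerMap_apply,
    Matrix.one_apply]
  by_cases hs : s r = s' r
  · have : (∀ a, a ≠ q → a ≠ r → s a = s' a) ↔ ∀ a, a ≠ q → s a = s' a := by
      refine forall_congr' fun a => forall_congr' fun h1 => ⟨fun h => ?_, fun h _ => h⟩
      by_cases h2 : a = r
      · rw [h2, hs]
      · exact h h2
    simp only [this, hs, if_true, mul_one]
  · rw [if_neg (fun h : ∀ a, a ≠ q → s a = s' a => hs (h r hr))]
    simp [hs]

theorem diagonal_mem_unitaryGroup {n : Type*} [Fintype n] [DecidableEq n] {v : n → ℂ}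
    (hv : ∀ i, ‖v i‖ = 1) : Matrix.diagonal v ∈ Matrix.unitaryGroup n ℂ := by
  rw [Matrix.mem_unitaryGroup_iff, Matrix.star_eq_conjTranspose, Matrix.diagonal_conjTranspose,
    Matrix.diagonal_mul_diagonal, ← Matrix.diagonal_one]
  congr 1
  funext i
  simp [Complex.mul_conj, Complex.normSq_eq_norm_sq, hv]

theorem exists_gate_diagonal {q r : Q} (h : q ≠ r) {v : Fin 2 × Fin 2 → ℂ}
    (hv : ∀ x, ‖v x‖ = 1) :
    ∃ g : TwoQubitGate Q, g.toMatrix = Matrix.diagonal fun s => v (s q, s r) := by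
  refine ⟨⟨q, r, h, ⟨_, diagonal_mem_unitaryGroup hv⟩⟩, ?_⟩
  ext s s'
  simp only [TwoQubitGate.toMatrix, Matrix.of_apply, Matrix.diagonal_apply, Prod.mk.injEq]
  by_cases hs : s = s'
  · subst hs; simp
  · rw [if_neg hs]
    split_ifs with h1 h2
    · exfalso
      apply hs
      funext a
      by_cases e1 : a = q
      · rw [e1]; exact h2.1
      · by_cases e2 : a = r
        · rw [e2]; exact h2.2
        · exact h1 a e1 e2
    · rfl
    · rfl

theorem exists_gate_swap {q r : Q} (h : q ≠ r) :
    ∃ g : TwoQubitGate Q, g.toMatrix = permuteMatrix (Equiv.swap q r) := by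
  have hU : (Matrix.of fun x y : Fin 2 × Fin 2 => if y = x.swap then (1 : ℂ) else 0) ∈
      Matrix.unitaryGroup (Fin 2 × Fin 2) ℂ := by
    rw [Matrix.mem_unitaryGroup_iff]
    ext x y
    simp [Matrix.mul_apply, Matrix.one_apply, Matrix.star_apply, eq_comm]
  refine ⟨⟨q, r, h, ⟨_, hU⟩⟩, ?_⟩
  ext s s'
  simp only [TwoQubitGate.toMatrix, permuteMatrix, Matrix.of_apply, Prod.swap_prod_mk,
    Prod.mk.injEq]
  rw [← ite_and]
  congr 1
  refine propext ⟨fun ⟨h1, h2, h3⟩ => ?_, ?_⟩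
  · funext a
    by_cases e1 : a = q
    · simp [e1, h2]
    · by_cases e2 : a = r
      · simp [e2, h3]
      · simp [Equiv.swap_apply_of_ne_of_ne e1 e2, h1 a e1 e2]
  · rintro rfl
    refine ⟨fun a h1 h2 => ?_, by simp, by simp⟩
    simp [Equiv.swap_apply_of_ne_of_ne h1 h2]

theorem permuteMatrix_mul_apply (σ : Equiv.Perm Q) (A : Matrix (Q → Fin 2) (Q → Fin 2) ℂ)
    (s s' : Q → Fin 2) : (permuteMatrix σ * A) s s' = A (s ∘ σ) s' := by
  simp [Matrix.mul_apply, permuteMatrix]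

theorem permuteMatrix_mul (σ τ : Equiv.Perm Q) :
    permuteMatrix σ * permuteMatrix τ = permuteMatrix (σ * τ) := by
  ext s s'
  rw [permuteMatrix_mul_apply]
  rfl

/-- Every permutation of the qubits is a product of swaps, at most one for each moved qubit. -/
theorem exists_circuit_permuteMatrix (σ : Equiv.Perm Q) :
    ∃ C : Circuit Q, C.length ≤ σ.support.card ∧ Circuit.toMatrix C = permuteMatrix σ := by
  induction hn : σ.support.card using Nat.strong_induction_on generalizing σ with
  | _ n ih =>
    by_cases hσ : σ = 1
    · refine ⟨[], by simp, ?_⟩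
      ext s s'
      simp [hσ, Circuit.toMatrix, permuteMatrix, Matrix.one_apply, eq_comm]
    · obtain ⟨a, ha⟩ : ∃ a, σ a ≠ a := by
        by_contra! h
        exact hσ (Equiv.ext h)
      -- Composing with the swap of `a` and `σ a` fixes `a` and moves no new qubit, so the support
      -- shrinks.
      have hlt := Equiv.Perm.card_support_swap_mul ha
      obtain ⟨C, hC, hCm⟩ := ih _ (hn ▸ hlt) (Equiv.swap a (σ a) * σ) rfl
      obtain ⟨g, hg⟩ := exists_gate_swap (Q := Q) (Ne.symm ha)
      refine ⟨C ++ [g], ?_, ?_⟩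
      · simp only [List.length_append, List.length_singleton]
        omega
      · rw [Circuit.toMatrix_append, Circuit.toMatrix_singleton, hCm, hg, permuteMatrix_mul,
          ← mul_assoc, Equiv.swap_mul_self, one_mul]

end Gates

/-! ### Layers of one-qubit gates and controlled phases, and their perturbation -/

section Layers

variable {Q : Type} [Fintype Q] [DecidableEq Q]

/-- The total phase picked up by qubit `q` from controlled phase gates with angles `θ q r`. -/
def phaseAngle (θ : Q → Q → ℝ) (q : Q) (s : Q → Fin 2) : ℝ :=
  ∑ r, θ q r * ((s q : ℕ) : ℝ) * ((s r : ℕ) : ℝ)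

/-- The operator which, for the qubits `q` of a list, the head being treated last, applies
`V q` to `q` and then controlled phases with angles `θ q r` to `q` and the qubits `r`. -/
noncomputable def layeredMatrix (V : Q → Matrix (Fin 2) (Fin 2) ℂ) (θ : Q → Q → ℝ) :
    List Q → Matrix (Q → Fin 2) (Q → Fin 2) ℂ
  | [] => 1
  | q :: L => Matrix.diagonal (fun s => exp (I * (phaseAngle θ q s : ℂ))) * singleMatrix q (V q) *
      layeredMatrix V θ L

theorem exists_circuit_phases (q : Q) (θ : Q → ℝ) (S : Finset Q) (hq : q ∉ S) :
    ∃ C : Circuit Q, C.length = S.card ∧ Circuit.toMatrix C =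
      Matrix.diagonal fun s =>
        exp (I * ((∑ r ∈ S, θ r * ((s q : ℕ) : ℝ) * ((s r : ℕ) : ℝ) : ℝ) : ℂ)) := by
  induction S using Finset.induction_on with
  | empty => exact ⟨[], by simp, by simp [Circuit.toMatrix]⟩
  | insert r S hr ih =>
    obtain ⟨C, hC, hCm⟩ := ih (fun h => hq (Finset.mem_insert_of_mem h))
    have hqr : q ≠ r := fun h => hq (h ▸ Finset.mem_insert_self _ _)
    obtain ⟨g, hg⟩ := exists_gate_diagonal hqr
      (v := fun x => exp (I * ((θ r * ((x.1 : ℕ) : ℝ) * ((x.2 : ℕ) : ℝ) : ℝ) : ℂ)))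
      (fun x => by rw [mul_comm]; exact norm_exp_ofReal_mul_I _)
    refine ⟨C ++ [g], by simp [hC, Finset.card_insert_of_notMem hr], ?_⟩
    rw [Circuit.toMatrix_append, Circuit.toMatrix_singleton, hCm, hg,
      Matrix.diagonal_mul_diagonal]
    congr 1
    funext s
    rw [← Complex.exp_add, Finset.sum_insert hr]
    push_cast
    ring_nf

/-- Only nonzero angles cost a gate: each qubit needs one gate for `V q` and at most `b` controlled
phases. This is where truncating the angles saves gates. -/
theorem exists_circuit_layeredMatrix [Nontrivial Q] {V : Q → Matrix (Fin 2) (Fin 2) ℂ}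
    (hV : ∀ q, V q ∈ Matrix.unitaryGroup (Fin 2) ℂ) {θ : Q → Q → ℝ} (hθ : ∀ q, θ q q = 0)
    {b : ℕ} (hb : ∀ q, (Finset.univ.filter fun r => θ q r ≠ 0).card ≤ b) (L : List Q) :
    ∃ C : Circuit Q, C.length ≤ L.length * (b + 1) ∧
      Circuit.toMatrix C = layeredMatrix V θ L := by
  induction L with
  | nil => exact ⟨[], by simp, rfl⟩
  | cons q L ih =>
    obtain ⟨C, hC, hCm⟩ := ih
    obtain ⟨g, hg⟩ := exists_gate_singleMatrix q (hV q)
    obtain ⟨P, hP, hPm⟩ := exists_circuit_phases q (θ q) (Finset.univ.filter fun r => θ q r ≠ 0)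
      (by simp [hθ])
    refine ⟨C ++ ([g] ++ P), ?_, ?_⟩
    · have := hb q
      simp only [List.length_append, List.length_cons, List.length_nil, hP, add_mul]
      omega
    · rw [Circuit.toMatrix_append, Circuit.toMatrix_append, Circuit.toMatrix_singleton, hCm, hg,
        hPm, layeredMatrix]
      congr 3
      funext s
      congr 3
      rw [phaseAngle, Finset.sum_filter]
      refine Finset.sum_congr rfl fun r _ => ?_
      split_ifs with h
      · rfl
      · simp [not_not.mp h]

theorem singleMatrix_mul_apply (q : Q) (A : Matrix (Fin 2) (Fin 2) ℂ)
    (B : Matrix (Q → Fin 2) (Q → Fin 2) ℂ) (s s' : Q → Fin 2) :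
    (singleMatrix q A * B) s s' = ∑ x, A (s q) x * B (Function.update s q x) s' := by
  simp only [Matrix.mul_apply, singleMatrix, Matrix.of_apply, ite_mul, zero_mul]
  rw [sum_ite_eq_off q s (fun t => A (s q) (t q) * B t s')]
  simp

/-- The entries of the layered operator: if no qubit is controlled by one treated before it,
the controls of `q` are read off the input. -/
theorem layeredMatrix_apply {V : Q → Matrix (Fin 2) (Fin 2) ℂ} {θ : Q → Q → ℝ}
    (hθ : ∀ q, θ q q = 0) {L : List Q} (hL : L.Nodup)
    (hp : L.Pairwise fun q r => θ q r = 0) (s s' : Q → Fin 2) :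
    layeredMatrix V θ L s s' = if ∀ r ∉ L, s r = s' r then
      (L.map fun q => V q (s q) (s' q) *
        exp (I * ((∑ r, θ q r * ((s q : ℕ) : ℝ) * ((s' r : ℕ) : ℝ) : ℝ) : ℂ))).prod else 0 := by
  induction L generalizing s with
  | nil => simp [layeredMatrix, Matrix.one_apply, funext_iff]
  | cons q L ih =>
    rw [List.nodup_cons] at hL
    rw [List.pairwise_cons] at hp
    rw [layeredMatrix, Matrix.mul_assoc, Matrix.diagonal_mul, singleMatrix_mul_apply]
    simp only [ih hL.2 hp.2]
    -- The remaining layers do not change qubit `q`, so only the intermediate value `x = s' q`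
    -- contributes to the sum.
    have hiff : ∀ x, (∀ r ∉ L, Function.update s q x r = s' r) ↔
        x = s' q ∧ ∀ r ∉ q :: L, s r = s' r := by
      intro x
      constructor
      · intro h
        refine ⟨by simpa using h q hL.1, fun r hr => ?_⟩
        rw [List.mem_cons, not_or] at hr
        simpa [hr.1] using h r hr.2
      · rintro ⟨rfl, h⟩ r hr
        by_cases e : r = q
        · subst e; simp
        · simpa [e] using h r (by simp [e, hr])
    simp only [hiff]
    by_cases hs : ∀ r ∉ q :: L, s r = s' r
    · rw [if_pos hs, List.map_cons, List.prod_cons, Finset.sum_eq_single (s' q)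
        (fun x _ hx => by rw [if_neg (fun h => hx h.1), mul_zero]) (by simp),
        if_pos ⟨rfl, hs⟩]
      have hmap : (L.map fun p => V p (Function.update s q (s' q) p) (s' p) *
          exp (I * ((∑ r, θ p r * ((Function.update s q (s' q) p : ℕ) : ℝ) *
            ((s' r : ℕ) : ℝ) : ℝ) : ℂ))) = L.map fun p => V p (s p) (s' p) *
          exp (I * ((∑ r, θ p r * ((s p : ℕ) : ℝ) * ((s' r : ℕ) : ℝ) : ℝ) : ℂ)) := by
        refine List.map_congr_left fun p hpL => ?_
        have : p ≠ q := fun h => hL.1 (h ▸ hpL)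
        simp [Function.update_of_ne this]
      -- Qubits already treated (those in `L`) have angle zero, as has `q` itself; all others still
      -- carry their input value.
      have hang : phaseAngle θ q s = ∑ r, θ q r * ((s q : ℕ) : ℝ) * ((s' r : ℕ) : ℝ) := by
        refine Finset.sum_congr rfl fun r _ => ?_
        by_cases e : r = q
        · subst e; simp [hθ]
        · by_cases e' : r ∈ L
          · simp [hp.1 r e']
          · rw [hs r (by simp [e, e'])]
      rw [hmap, hang]
      ring
    · rw [if_neg hs, Finset.sum_eq_zero (fun x _ => by rw [if_neg (fun h => hs h.2), mul_zero]),
        mul_zero]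

section Norm

open scoped Matrix.Norms.L2Operator

theorem singleMatrix_mem_unitaryGroup [Nontrivial Q] (q : Q) {A : Matrix (Fin 2) (Fin 2) ℂ}
    (hA : A ∈ Matrix.unitaryGroup (Fin 2) ℂ) :
    singleMatrix q A ∈ Matrix.unitaryGroup (Q → Fin 2) ℂ := by
  obtain ⟨g, hg⟩ := exists_gate_singleMatrix q hA
  exact hg ▸ g.toMatrix_mem_unitaryGroup

/-- Telescoping: errors of unitary factors add up, because multiplication by a unitary preserves the
norm. -/
theorem norm_mul_sub_mul_le {n : Type*} [Fintype n] [DecidableEq n] {A A' B B' : Matrix n n ℂ}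
    (hA : A' ∈ Matrix.unitaryGroup n ℂ) (hB : B ∈ Matrix.unitaryGroup n ℂ) :
    ‖A * B - A' * B'‖ ≤ ‖A - A'‖ + ‖B - B'‖ := by
  have h : A * B - A' * B' = (A - A') * B + A' * (B - B') := by noncomm_ring
  rw [h]
  refine (norm_add_le _ _).trans_eq ?_
  rw [CStarRing.norm_mul_mem_unitary _ hB, CStarRing.norm_mem_unitary_mul _ hA]

theorem norm_exp_I_sub_exp_I_le (x y : ℝ) : ‖exp (I * x) - exp (I * y)‖ ≤ |x - y| := by
  have h : exp (I * x) - exp (I * y) = exp (y * I) * (exp (I * ((x - y : ℝ) : ℂ)) - 1) := by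
    rw [mul_sub, ← Complex.exp_add, mul_one]
    push_cast
    ring_nf
  rw [h, norm_mul, norm_exp_ofReal_mul_I, one_mul]
  exact Real.norm_exp_I_mul_ofReal_sub_one_le

omit [DecidableEq Q] in
theorem abs_phaseAngle_sub_le (θ θ' : Q → Q → ℝ) (q : Q) (s : Q → Fin 2) :
    |phaseAngle θ q s - phaseAngle θ' q s| ≤ ∑ r, |θ q r - θ' q r| := by
  rw [phaseAngle, phaseAngle, ← Finset.sum_sub_distrib]
  refine (Finset.abs_sum_le_sum_abs _ _).trans (Finset.sum_le_sum fun r _ => ?_)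
  rw [← sub_mul, ← sub_mul, abs_mul, abs_mul, mul_assoc]
  refine mul_le_of_le_one_right (abs_nonneg _) ?_
  have h : ∀ x : Fin 2, |((x : ℕ) : ℝ)| ≤ 1 := by
    intro x; fin_cases x <;> simp
  exact mul_le_one₀ (h _) (abs_nonneg _) (h _)

theorem diagonal_phase_mem_unitaryGroup {n : Type*} [Fintype n] [DecidableEq n] (f : n → ℝ) :
    Matrix.diagonal (fun s => exp (I * (f s : ℂ))) ∈ Matrix.unitaryGroup n ℂ :=
  diagonal_mem_unitaryGroup fun i => by rw [mul_comm]; exact norm_exp_ofReal_mul_I _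

theorem layeredMatrix_mem_unitaryGroup [Nontrivial Q] {V : Q → Matrix (Fin 2) (Fin 2) ℂ}
    (hV : ∀ q, V q ∈ Matrix.unitaryGroup (Fin 2) ℂ) (θ : Q → Q → ℝ) (L : List Q) :
    layeredMatrix V θ L ∈ Matrix.unitaryGroup (Q → Fin 2) ℂ := by
  induction L with
  | nil => exact one_mem _
  | cons q L ih =>
    exact mul_mem (mul_mem (diagonal_phase_mem_unitaryGroup _)
      (singleMatrix_mem_unitaryGroup q (hV q))) ih

/-- Perturbing the angles of the controlled phases. -/
theorem norm_layeredMatrix_sub_le [Nontrivial Q] {V : Q → Matrix (Fin 2) (Fin 2) ℂ}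
    (hV : ∀ q, V q ∈ Matrix.unitaryGroup (Fin 2) ℂ) {θ θ' : Q → Q → ℝ} {ε : ℝ} (hε : 0 ≤ ε)
    (h : ∀ q, ∑ r, |θ q r - θ' q r| ≤ ε) (L : List Q) :
    ‖layeredMatrix V θ L - layeredMatrix V θ' L‖ ≤ L.length * ε := by
  induction L with
  | nil => simp [layeredMatrix]
  | cons q L ih =>
    rw [layeredMatrix, layeredMatrix]
    refine (norm_mul_sub_mul_le (mul_mem (diagonal_phase_mem_unitaryGroup _)
      (singleMatrix_mem_unitaryGroup q (hV q)))
      (layeredMatrix_mem_unitaryGroup hV θ L)).trans ?_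
    -- The one-qubit gates agree, so a layer contributes only the sup norm of a difference of
    -- diagonal phases.
    rw [← sub_mul, CStarRing.norm_mul_mem_unitary _ (singleMatrix_mem_unitaryGroup q (hV q)),
      Matrix.diagonal_sub, Matrix.l2_opNorm_diagonal]
    have hd : ‖fun s => exp (I * (phaseAngle θ q s : ℂ)) - exp (I * (phaseAngle θ' q s : ℂ))‖ ≤
        ε := by
      refine (pi_norm_le_iff_of_nonneg hε).mpr fun s => ?_
      exact (norm_exp_I_sub_exp_I_le _ _).trans ((abs_phaseAngle_sub_le θ θ' q s).trans (h q))
    push_cast [List.length_cons]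
    linarith

end Norm

/-- A circuit of one-qubit phase gates. -/
theorem exists_circuit_diagonal_sum [Nontrivial Q] (f : Q → Fin 2 → ℝ) :
    ∃ C : Circuit Q, C.length ≤ Fintype.card Q ∧ Circuit.toMatrix C =
      Matrix.diagonal fun s => exp (I * ((∑ q, f q (s q) : ℝ) : ℂ)) := by
  suffices h : ∀ S : Finset Q, ∃ C : Circuit Q, C.length ≤ S.card ∧ Circuit.toMatrix C =
      Matrix.diagonal fun s => exp (I * ((∑ q ∈ S, f q (s q) : ℝ) : ℂ)) from h Finset.univ
  intro S
  induction S using Finset.induction_on with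
  | empty => exact ⟨[], by simp, by simp [Circuit.toMatrix]⟩
  | insert q S hq ih =>
    obtain ⟨C, hC, hCm⟩ := ih
    obtain ⟨r, hr⟩ := exists_ne q
    obtain ⟨g, hg⟩ := exists_gate_diagonal hr.symm (v := fun x => exp (I * (f q x.1 : ℂ)))
      (fun x => by rw [mul_comm]; exact norm_exp_ofReal_mul_I _)
    refine ⟨C ++ [g], by simp [hC, Finset.card_insert_of_notMem hq], ?_⟩
    rw [Circuit.toMatrix_append, Circuit.toMatrix_singleton, hCm, hg,
      Matrix.diagonal_mul_diagonal]
    congr 1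
    funext s
    rw [← Complex.exp_add, Finset.sum_insert hq]
    push_cast
    ring_nf

end Layers

/-! ### The exact quantum Fourier circuit -/

section FourierCircuit

theorem lo_ne_hi {d : ℕ} (r : Fin (d + 1)) : lo r ≠ hi r := by
  unfold lo hi
  split_ifs
  · linarith [Real.pi_pos]
  · norm_num

/-- The interval length cancels between grid points and wave numbers, so the `x` and `p` registers
share one matrix. -/
theorem Phi_apply {a b : ℝ} (hab : a ≠ b) (m : ℕ) (j l : Fin (2 ^ m)) :
    Phi a b m j l = exp (I * ((2 * Real.pi * ((j : ℕ) : ℝ) *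
      (((l : ℕ) : ℝ) - 2 ^ m / 2) / 2 ^ m : ℝ) : ℂ)) := by
  have h : b - a ≠ 0 := sub_ne_zero.mpr hab.symm
  simp only [Phi, Matrix.of_apply, specBasis, node, waveNumber]
  congr 3
  field_simp
  ring

/-- The Hadamard gate followed by a phase that accounts for the shift of the wave numbers. -/
noncomputable def shiftedHadamard (m i : ℕ) : Matrix (Fin 2) (Fin 2) ℂ :=
  Matrix.of fun a c => ((1 / Real.sqrt 2 : ℝ) : ℂ) *
    exp (I * ((Real.pi * ((a : ℕ) : ℝ) * ((c : ℕ) : ℝ) -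
      Real.pi * ((a : ℕ) : ℝ) * 2 ^ m / 2 ^ (i + 1) : ℝ) : ℂ))

theorem shiftedHadamard_mem_unitaryGroup (m i : ℕ) :
    shiftedHadamard m i ∈ Matrix.unitaryGroup (Fin 2) ℂ := by
  have hH : (Matrix.of fun a c : Fin 2 => ((1 / Real.sqrt 2 : ℝ) : ℂ) *
      exp (I * ((Real.pi * ((a : ℕ) : ℝ) * ((c : ℕ) : ℝ) : ℝ) : ℂ))) ∈
      Matrix.unitaryGroup (Fin 2) ℂ := by
    have h2 : ((Real.sqrt 2 : ℝ) : ℂ) * ((Real.sqrt 2 : ℝ) : ℂ) = 2 := by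
      rw [← ofReal_mul, Real.mul_self_sqrt (by norm_num)]; norm_num
    have h3 : ((Real.sqrt 2 : ℝ) : ℂ)⁻¹ * ((Real.sqrt 2 : ℝ) : ℂ)⁻¹ = 1 / 2 := by
      rw [← mul_inv, h2]; norm_num
    have he : exp (I * Real.pi) = -1 := by rw [mul_comm]; exact exp_pi_mul_I
    rw [Matrix.mem_unitaryGroup_iff]
    ext a c
    fin_cases a <;> fin_cases c <;>
      simp [Matrix.mul_apply, Fin.sum_univ_two, Matrix.star_apply, he, h3]
    norm_num
  -- The wave number shift depends on the output bit only, hence is a diagonal unitary applied after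
  -- the Hadamard gate.
  have hD := diagonal_phase_mem_unitaryGroup
    (fun a : Fin 2 => -(Real.pi * ((a : ℕ) : ℝ) * 2 ^ m / 2 ^ (i + 1)))
  convert mul_mem hD hH using 1
  ext a c
  rw [Matrix.diagonal_mul, shiftedHadamard, Matrix.of_apply, Matrix.of_apply, mul_left_comm,
    ← Complex.exp_add]
  congr 2
  push_cast
  ring

/-- The angles of the controlled phase gates of the quantum Fourier transform. -/
noncomputable def fourierAngle (d m : ℕ) (q r : Qubits d m) : ℝ :=
  if q.1 = r.1 ∧ r.2 < q.2 then 2 * Real.pi * 2 ^ (r.2 : ℕ) / 2 ^ ((q.2 : ℕ) + 1) else 0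

/-- The bit reversal in each register. -/
def bitReversal (d m : ℕ) : Equiv.Perm (Qubits d m) :=
  Equiv.prodCongr (Equiv.refl _) Fin.revPerm

/-- Bits above `i` contribute integer multiples of `2π` and drop out, bit `i` gives the Hadamard
sign, and the lower bits give the controlled phases. -/
theorem exp_binary_phase {m : ℕ} (i : Fin m) (a : ℕ) (c : Fin m → Fin 2) :
    exp (I * ((2 * Real.pi * a * (∑ k, ((c k : ℕ) : ℝ) * 2 ^ (k : ℕ)) /
      2 ^ ((i : ℕ) + 1) : ℝ) : ℂ)) =
    exp (I * ((Real.pi * a * ((c i : ℕ) : ℝ) + ∑ k, (if k < i then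
      2 * Real.pi * 2 ^ (k : ℕ) / 2 ^ ((i : ℕ) + 1) else 0) * a * ((c k : ℕ) : ℝ) : ℝ) : ℂ)) := by
  have key : 2 * Real.pi * a * (∑ k, ((c k : ℕ) : ℝ) * 2 ^ (k : ℕ)) / 2 ^ ((i : ℕ) + 1) =
      (Real.pi * a * ((c i : ℕ) : ℝ) + ∑ k, (if k < i then
      2 * Real.pi * 2 ^ (k : ℕ) / 2 ^ ((i : ℕ) + 1) else 0) * a * ((c k : ℕ) : ℝ)) +
      2 * Real.pi * ((∑ k, if i < k then a * (c k : ℕ) * 2 ^ ((k : ℕ) - i - 1) else 0 : ℕ) : ℝ) := by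
    have hi : Real.pi * a * ((c i : ℕ) : ℝ) =
        ∑ k, if k = i then Real.pi * a * ((c k : ℕ) : ℝ) else 0 := by simp
    rw [hi, Nat.cast_sum, Finset.mul_sum, Finset.mul_sum, Finset.sum_div,
      ← Finset.sum_add_distrib, ← Finset.sum_add_distrib]
    refine Finset.sum_congr rfl fun k _ => ?_
    rcases lt_trichotomy k i with h | h | h
    · simp [h, h.ne, h.asymm]; ring
    · subst h
      simp [pow_succ]; field_simp
    · have h2 : (2 : ℝ) ^ (k : ℕ) = 2 ^ ((k : ℕ) - i - 1) * 2 ^ ((i : ℕ) + 1) := by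
        rw [← pow_add]; congr 1; have : (i : ℕ) < k := h; omega
      simp [h, h.ne', h.asymm, h2]; field_simp
  rw [key, ofReal_add, mul_add, Complex.exp_add]
  set N := (∑ k, if i < k then a * (c k : ℕ) * 2 ^ ((k : ℕ) - i - 1) else 0 : ℕ)
  have : exp (I * ((2 * Real.pi * (N : ℝ) : ℝ) : ℂ)) = 1 := by
    have := Complex.exp_nat_mul_two_pi_mul_I N
    rw [← this]; congr 1; push_cast; ring
  rw [this, mul_one]

/-- The Fourier matrix of one register as a product over its qubits. -/
theorem scaled_Phi_apply {a b : ℝ} (hab : a ≠ b) {m : ℕ} (x c : Fin m → Fin 2) :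
    ((1 / Real.sqrt (2 ^ m) : ℝ) : ℂ) * Phi a b m (finFunctionFinEquiv x) (finFunctionFinEquiv c) =
      ∏ i : Fin m, shiftedHadamard m i (x i.rev) (c i) *
        exp (I * ((∑ k, (if k < i then 2 * Real.pi * 2 ^ (k : ℕ) / 2 ^ ((i : ℕ) + 1) else 0) *
          ((x i.rev : ℕ) : ℝ) * ((c k : ℕ) : ℝ) : ℝ) : ℂ)) := by
  have hfac : ∀ i : Fin m, shiftedHadamard m i (x i.rev) (c i) *
        exp (I * ((∑ k, (if k < i then 2 * Real.pi * 2 ^ (k : ℕ) / 2 ^ ((i : ℕ) + 1) else 0) *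
          ((x i.rev : ℕ) : ℝ) * ((c k : ℕ) : ℝ) : ℝ) : ℂ)) =
      ((1 / Real.sqrt 2 : ℝ) : ℂ) * exp (I * ((2 * Real.pi * ((x i.rev : ℕ) : ℝ) *
        ((∑ k, ((c k : ℕ) : ℝ) * 2 ^ (k : ℕ)) - 2 ^ m / 2) / 2 ^ ((i : ℕ) + 1) : ℝ) : ℂ)) := by
    intro i
    have h1 : 2 * Real.pi * ((x i.rev : ℕ) : ℝ) *
        ((∑ k, ((c k : ℕ) : ℝ) * 2 ^ (k : ℕ)) - 2 ^ m / 2) / 2 ^ ((i : ℕ) + 1) =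
        2 * Real.pi * ((x i.rev : ℕ) : ℝ) * (∑ k, ((c k : ℕ) : ℝ) * 2 ^ (k : ℕ)) /
          2 ^ ((i : ℕ) + 1) + -(Real.pi * ((x i.rev : ℕ) : ℝ) * 2 ^ m / 2 ^ ((i : ℕ) + 1)) := by
      ring
    rw [h1, ofReal_add, mul_add, Complex.exp_add, exp_binary_phase, shiftedHadamard,
      Matrix.of_apply, mul_assoc, ← Complex.exp_add, ← Complex.exp_add]
    congr 2
    push_cast
    ring
  simp only [hfac]
  rw [Finset.prod_mul_distrib, Finset.prod_const, Finset.card_univ, Fintype.card_fin,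
    ← Complex.exp_sum, ← Finset.mul_sum, ← ofReal_sum, Phi_apply hab, ← ofReal_pow]
  have hs : 1 / Real.sqrt (2 ^ m) = (1 / Real.sqrt 2) ^ m := by
    rw [div_pow, one_pow]
    congr 1
    rw [Real.sqrt_eq_iff_mul_self_eq (by positivity) (by positivity), ← mul_pow,
      Real.mul_self_sqrt (by norm_num)]
  rw [hs]
  congr 4
  rw [finFunctionFinEquiv_apply, finFunctionFinEquiv_apply]
  push_cast
  -- Qubit `i` produces output bit `m - 1 - i`, whose weight is `2 ^ (m - 1 - i) / 2 ^ m = 1 / 2 ^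
  -- (i + 1)`; hence the bit reversal.
  rw [← Equiv.sum_comp Fin.revPerm, Finset.mul_sum, Finset.sum_mul, Finset.sum_div]
  refine Finset.sum_congr rfl fun i _ => ?_
  have h2 : (2 : ℝ) ^ m = 2 ^ ((Fin.revPerm i : Fin m) : ℕ) * 2 ^ ((i : ℕ) + 1) := by
    rw [← pow_add]; congr 1; simp [Fin.val_rev]
  rw [Fin.revPerm_apply] at *
  rw [div_eq_div_iff (by positivity) (by positivity), h2]
  ring

/-- Since the head of the list is treated last, increasing order within a register treats
significant qubits first, while their less significant controls are untouched. -/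
theorem exists_qubit_order (d m : ℕ) : ∃ L : List (Qubits d m), L.Nodup ∧ (∀ q, q ∈ L) ∧
    L.length = (d + 1) * m ∧ L.Pairwise fun q r => q.1 = r.1 → q.2 < r.2 := by
  refine ⟨(List.finRange ((d + 1) * m)).map finProdFinEquiv.symm, ?_, ?_, ?_, ?_⟩
  · exact (List.nodup_finRange _).map finProdFinEquiv.symm.injective
  · intro q
    exact List.mem_map.mpr ⟨finProdFinEquiv q, List.mem_finRange _, by simp⟩
  · simp
  · rw [List.pairwise_map]
    refine (List.pairwise_lt_finRange _).imp fun {x y} hxy h => ?_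
    obtain ⟨⟨r, i⟩, rfl⟩ := finProdFinEquiv.surjective x
    obtain ⟨⟨r', i'⟩, rfl⟩ := finProdFinEquiv.surjective y
    simp only [Equiv.symm_apply_apply] at h ⊢
    subst h
    have h' : (i : ℕ) + m * r < i' + m * r := hxy
    exact Fin.lt_def.mpr (by omega)

theorem sum_fourierAngle {d m : ℕ} (q : Qubits d m) (a : ℝ) (f : Qubits d m → ℝ) :
    ∑ r, fourierAngle d m q r * a * f r = ∑ k, (if k < q.2 then
      2 * Real.pi * 2 ^ (k : ℕ) / 2 ^ ((q.2 : ℕ) + 1) else 0) * a * f (q.1, k) := by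
  rw [Fintype.sum_prod_type, Finset.sum_eq_single q.1]
  · simp [fourierAngle]
  · intro r _ hr
    simp [fourierAngle, hr.symm]
  · simp

theorem permute_layered_apply {d m : ℕ} {L : List (Qubits d m)} (hL : L.Nodup)
    (hmem : ∀ q, q ∈ L) (hp : L.Pairwise fun q r => q.1 = r.1 → q.2 < r.2)
    (s s' : Qubits d m → Fin 2) :
    (permuteMatrix (bitReversal d m) *
      layeredMatrix (fun q => shiftedHadamard m q.2) (fourierAngle d m) L) s s' =
      qft d m (gridEquiv d m s) (gridEquiv d m s') := by
  have hp' : L.Pairwise fun q r => fourierAngle d m q r = 0 :=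
    hp.imp fun {q r} h => if_neg fun h' => (h h'.1).asymm h'.2
  rw [permuteMatrix_mul_apply, layeredMatrix_apply (by simp [fourierAngle]) hL hp', if_pos (by simp [hmem]),
    ← List.prod_toFinset _ hL, show L.toFinset = Finset.univ by ext; simp [hmem],
    Fintype.prod_prod_type, qft, tensorOp, Matrix.of_apply]
  refine Finset.prod_congr rfl fun r _ => ?_
  rw [Matrix.smul_apply, smul_eq_mul]
  have := scaled_Phi_apply (lo_ne_hi r) (fun i => s (r, i)) (fun i => s' (r, i))
  refine Eq.trans ?_ this.symm
  refine Finset.prod_congr rfl fun i _ => ?_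
  rw [sum_fourierAngle (r, i) _ (fun q => ((s' q : ℕ) : ℝ))]
  rfl

end FourierCircuit

/-! ### Operators on the grid and the truncated Fourier circuit -/

section GridOperators

open scoped Matrix.Norms.L2Operator

variable {d m : ℕ}

theorem circuitOp_append (C C' : Circuit (Qubits d m)) :
    circuitOp (C ++ C') = circuitOp C' * circuitOp C := by
  rw [circuitOp, Circuit.toMatrix_append]
  exact map_mul (Matrix.reindexAlgEquiv ℂ ℂ (gridEquiv d m)) _ _

theorem reindex_mem_unitaryGroup {n p : Type*} [Fintype n] [DecidableEq n] [Fintype p]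
    [DecidableEq p] (e : n ≃ p) {A : Matrix n n ℂ} (hA : A ∈ Matrix.unitaryGroup n ℂ) :
    Matrix.reindex e e A ∈ Matrix.unitaryGroup p ℂ := by
  rw [Matrix.mem_unitaryGroup_iff] at hA ⊢
  have h := congrArg (Matrix.reindexAlgEquiv ℂ ℂ e) hA
  rw [map_mul, map_one] at h
  rw [Matrix.star_eq_conjTranspose, Matrix.conjTranspose_reindex]
  exact h

/-- Renaming the basis as a `*`-homomorphism. -/
def reindexStarHom {n p : Type*} [Fintype n] [DecidableEq n] [Fintype p]
    [DecidableEq p] (e : n ≃ p) : Matrix n n ℂ →⋆ₐ[ℂ] Matrix p p ℂ :=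
  { (Matrix.reindexAlgEquiv ℂ ℂ e : Matrix n n ℂ →ₐ[ℂ] Matrix p p ℂ) with
    map_star' := fun A => (Matrix.conjTranspose_reindex e e A).symm }

/-- An injective `*`-homomorphism of C*-algebras is isometric. -/
theorem norm_reindex {n p : Type*} [Fintype n] [DecidableEq n] [Fintype p]
    [DecidableEq p] (e : n ≃ p) (A : Matrix n n ℂ) : ‖Matrix.reindex e e A‖ = ‖A‖ :=
  NonUnitalStarAlgHom.norm_map (reindexStarHom e)
    (Matrix.reindexAlgEquiv ℂ ℂ e).injective A

theorem opNorm_eq (A : Matrix (Grid d m) (Grid d m) ℂ) : opNorm A = ‖A‖ := rfl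

theorem circuitOp_mem_unitaryGroup (C : Circuit (Qubits d m)) :
    circuitOp C ∈ Matrix.unitaryGroup (Grid d m) ℂ :=
  reindex_mem_unitaryGroup _ (Circuit.toMatrix_mem_unitaryGroup C)

theorem circuitOp_inverse (C : Circuit (Qubits d m)) :
    circuitOp (Circuit.inverse C) = (circuitOp C)ᴴ := by
  rw [circuitOp, circuitOp, Circuit.inverse_toMatrix, Matrix.conjTranspose_reindex]

theorem permuteMatrix_mem_unitaryGroup {Q : Type} [Fintype Q] [DecidableEq Q]
    (σ : Equiv.Perm Q) : permuteMatrix σ ∈ Matrix.unitaryGroup (Q → Fin 2) ℂ := by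
  obtain ⟨C, -, hC⟩ := exists_circuit_permuteMatrix σ
  exact hC ▸ Circuit.toMatrix_mem_unitaryGroup C

theorem reindex_permute_layered {L : List (Qubits d m)} (hL : L.Nodup)
    (hmem : ∀ q, q ∈ L) (hp : L.Pairwise fun q r => q.1 = r.1 → q.2 < r.2) :
    Matrix.reindex (gridEquiv d m) (gridEquiv d m) (permuteMatrix (bitReversal d m) *
      layeredMatrix (fun q => shiftedHadamard m q.2) (fourierAngle d m) L) = qft d m := by
  ext j l
  rw [Matrix.reindex_apply, Matrix.submatrix_apply, permute_layered_apply hL hmem hp]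
  simp

theorem nontrivial_qubits (d : ℕ) (hm : 2 ≤ m) : Nontrivial (Qubits d m) := by
  have : Nontrivial (Fin m) := Fin.nontrivial_iff_two_le.mpr hm
  infer_instance

/-- Unitarity comes from the exact circuit, without summing roots of unity. -/
theorem qft_mem_unitaryGroup (d : ℕ) (hm : 2 ≤ m) :
    qft d m ∈ Matrix.unitaryGroup (Grid d m) ℂ := by
  have := nontrivial_qubits d hm
  obtain ⟨L, hL, hmem, -, hp⟩ := exists_qubit_order d m
  have h := mul_mem (permuteMatrix_mem_unitaryGroup (bitReversal d m))
    (layeredMatrix_mem_unitaryGroup (V := fun q : Qubits d m => shiftedHadamard m q.2)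
      (fun q => shiftedHadamard_mem_unitaryGroup m q.2) (fourierAngle d m) L)
  have h' := reindex_mem_unitaryGroup (gridEquiv d m) h
  rwa [reindex_permute_layered hL hmem hp] at h'

/-- The angles of the approximate Fourier transform, in which only the interactions of qubits at
distance at most `b` are kept. -/
noncomputable def truncatedAngle (d m b : ℕ) (q r : Qubits d m) : ℝ :=
  if (q.2 : ℕ) ≤ r.2 + b then fourierAngle d m q r else 0

theorem card_truncatedAngle_ne_zero (b : ℕ) (q : Qubits d m) :
    (Finset.univ.filter fun r => truncatedAngle d m b q r ≠ 0).card ≤ b := by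
  have key : ∀ r, truncatedAngle d m b q r ≠ 0 →
      q.1 = r.1 ∧ (r.2 : ℕ) < q.2 ∧ (q.2 : ℕ) ≤ r.2 + b := by
    intro r hr
    unfold truncatedAngle fourierAngle at hr
    split_ifs at hr with h1 h2
    · exact ⟨h2.1, h2.2, h1⟩
    all_goals exact absurd rfl hr
  refine (Finset.card_le_card_of_injOn (fun r => (q.2 : ℕ) - r.2 - 1) (t := Finset.range b)
    ?_ ?_).trans_eq (Finset.card_range b)
  · intro r hr
    have := key r (by simpa using hr)
    simp only [Finset.coe_range, Set.mem_Iio]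
    omega
  · intro r hr r' hr' h
    have h1 := key r (by simpa using hr)
    have h2 := key r' (by simpa using hr')
    simp only at h
    exact Prod.ext (h1.1.symm.trans h2.1) (Fin.ext (by omega))

/-- A dropped angle belongs to a distance of at least `b + 1`, so it is at most `2π / 2 ^ (b + 2) ≤
2 / 2 ^ b`; a qubit has at most `m` partners. -/
theorem sum_abs_fourierAngle_sub_le (b : ℕ) (q : Qubits d m) :
    ∑ r, |fourierAngle d m q r - truncatedAngle d m b q r| ≤ m * (2 / 2 ^ b) := by
  have key : ∀ r, |fourierAngle d m q r - truncatedAngle d m b q r| ≤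
      if q.1 = r.1 then 2 / 2 ^ b else 0 := by
    intro r
    unfold truncatedAngle
    by_cases h1 : (q.2 : ℕ) ≤ r.2 + b
    · rw [if_pos h1, sub_self, abs_zero]
      split_ifs <;> positivity
    · rw [if_neg h1, sub_zero, fourierAngle]
      by_cases h2 : q.1 = r.1
      · rw [if_pos h2]
        split_ifs with h3
        · rw [abs_of_nonneg (by positivity), div_le_div_iff₀ (by positivity) (by positivity)]
          have h4 : (2 : ℝ) ^ ((r.2 : ℕ) + b + 2) ≤ 2 ^ ((q.2 : ℕ) + 1) :=
            pow_le_pow_right₀ (by norm_num) (by omega)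
          have h5 : (2 : ℝ) ^ ((r.2 : ℕ) + b + 2) = 2 ^ (r.2 : ℕ) * 2 ^ b * 4 := by
            rw [pow_add, pow_add]; norm_num
          have h6 : 0 < (2 : ℝ) ^ (r.2 : ℕ) * 2 ^ b := by positivity
          nlinarith [Real.pi_le_four]
        · rw [abs_zero]; positivity
      · simp [h2]
  refine (Finset.sum_le_sum fun r _ => key r).trans_eq ?_
  rw [Fintype.sum_prod_type_right]
  simp

/-- The approximate quantum Fourier transform. -/
theorem exists_circuit_qft (d : ℕ) (hm : 2 ≤ m) (b : ℕ) :
    ∃ C : Circuit (Qubits d m), C.length ≤ (d + 1) * m * (b + 2) ∧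
      opNorm (circuitOp C - qft d m) ≤ (d + 1) * m * (m * (2 / 2 ^ b)) := by
  have := nontrivial_qubits d hm
  obtain ⟨L, hL, hmem, hlen, hp⟩ := exists_qubit_order d m
  have hV : ∀ q : Qubits d m, shiftedHadamard m q.2 ∈ Matrix.unitaryGroup (Fin 2) ℂ :=
    fun q => shiftedHadamard_mem_unitaryGroup m q.2
  obtain ⟨C, hC, hCm⟩ := exists_circuit_layeredMatrix hV
    (θ := truncatedAngle d m b) (by simp [truncatedAngle, fourierAngle])
    (card_truncatedAngle_ne_zero b) L
  obtain ⟨P, hP, hPm⟩ := exists_circuit_permuteMatrix (bitReversal d m)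
  refine ⟨C ++ P, ?_, ?_⟩
  -- The layers cost `b + 1` gates per qubit and the bit reversal at most one more.
  · have h1 : (bitReversal d m).support.card ≤ (d + 1) * m := by
      refine (Finset.card_le_univ _).trans_eq ?_
      simp [Fintype.card_prod]
    rw [List.length_append]
    rw [hlen] at hC
    nlinarith
  · have h1 : circuitOp (C ++ P) - qft d m = Matrix.reindex (gridEquiv d m) (gridEquiv d m)
        (permuteMatrix (bitReversal d m) *
          (layeredMatrix (fun q => shiftedHadamard m q.2) (truncatedAngle d m b) L -
            layeredMatrix (fun q => shiftedHadamard m q.2) (fourierAngle d m) L)) := by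
      rw [← reindex_permute_layered hL hmem hp, circuitOp, Circuit.toMatrix_append, hCm, hPm,
        mul_sub]
      rfl
    have hσ := permuteMatrix_mem_unitaryGroup (bitReversal d m)
    rw [h1, opNorm_eq, norm_reindex, CStarRing.norm_mem_unitary_mul _ hσ, norm_sub_rev]
    have h2 := norm_layeredMatrix_sub_le hV (ε := m * (2 / 2 ^ b)) (by positivity)
      (sum_abs_fourierAngle_sub_le b) L
    refine h2.trans_eq ?_
    rw [hlen]
    push_cast
    ring

theorem clog_le_log (hm : 2 ≤ m) : (Nat.clog 2 m : ℝ) ≤ 3 * Real.log m ∧ 1 ≤ 2 * Real.log m := by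
  have hlog2 := Real.log_two_gt_d9
  have hm' : (2 : ℝ) ≤ m := by exact_mod_cast hm
  have h2 : Real.log 2 ≤ Real.log m := Real.log_le_log (by norm_num) hm'
  refine ⟨?_, by linarith⟩
  have h1 : 2 ^ (Nat.clog 2 m).pred < m := Nat.pow_pred_clog_lt_self (by norm_num) (by omega)
  have h3 : ((Nat.clog 2 m).pred : ℝ) * Real.log 2 ≤ Real.log m := by
    rw [← Real.log_pow]
    exact Real.log_le_log (by positivity) (by exact_mod_cast h1.le)
  have h4 : (Nat.clog 2 m : ℝ) ≤ (Nat.clog 2 m).pred + 1 := by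
    exact_mod_cast (by rw [Nat.pred_eq_sub_one]; omega :
      Nat.clog 2 m ≤ (Nat.clog 2 m).pred + 1)
  nlinarith [Nat.cast_nonneg (α := ℝ) (Nat.clog 2 m).pred]

theorem exists_circuit_qft_log (d k : ℕ) (hm : 2 ≤ m) :
    ∃ C : Circuit (Qubits d m),
      (C.length : ℝ) ≤ (3 * k + 12) * ((d + 1) * m * Real.log m) ∧
      opNorm (circuitOp C - qft d m) ≤ (d + 1) / (m : ℝ) ^ k := by
  -- The error bound is `(d + 1) * m ^ 2 * 2 / 2 ^ b`: the two extra powers of `m` are absorbed by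
  -- `k + 2`, the factor `2` by the `+ 1`.
  obtain ⟨C, hC, hCn⟩ := exists_circuit_qft d hm ((k + 2) * Nat.clog 2 m + 1)
  obtain ⟨h1, h2⟩ := clog_le_log hm
  have hm0 : (0 : ℝ) < m := by exact_mod_cast (by omega : 0 < m)
  refine ⟨C, ?_, hCn.trans ?_⟩
  · have h3 : (C.length : ℝ) ≤ (d + 1) * m * ((k + 2) * Nat.clog 2 m + 1 + 2) := by
      exact_mod_cast hC
    have h4 : ((k : ℝ) + 2) * Nat.clog 2 m ≤ (k + 2) * (3 * Real.log m) := by gcongr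
    calc (C.length : ℝ) ≤ _ := h3
      _ ≤ (d + 1) * m * ((3 * k + 12) * Real.log m) := by
        gcongr
        linarith
      _ = _ := by ring
  · have h3 : (m : ℝ) ^ (k + 2) ≤ 2 ^ ((k + 2) * Nat.clog 2 m) := by
      rw [mul_comm, pow_mul]
      gcongr
      exact_mod_cast Nat.le_pow_clog (by norm_num) m
    have h4 : (0 : ℝ) < d + 1 := by positivity
    rw [pow_succ]
    rw [show (d + 1 : ℝ) * m * (m * (2 / (2 ^ ((k + 2) * Nat.clog 2 m) * 2))) =
      (d + 1) * ((m : ℝ) ^ 2 / 2 ^ ((k + 2) * Nat.clog 2 m)) by field_simp, div_eq_mul_one_div (d + 1 : ℝ)]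
    refine mul_le_mul_of_nonneg_left ?_ h4.le
    rw [div_le_div_iff₀ (by positivity) (by positivity), one_mul, ← pow_add, add_comm 2]
    exact h3

end GridOperators

/-! ### Diagonalisation in momentum space -/

section Spectral

variable {d m : ℕ}

theorem tensorOp_mul (A B : Fin (d + 1) → Matrix (Fin (2 ^ m)) (Fin (2 ^ m)) ℂ) :
    tensorOp A * tensorOp B = tensorOp fun r => A r * B r := by
  ext j l
  simp only [tensorOp, Matrix.mul_apply, Matrix.of_apply]
  rw [Finset.prod_univ_sum, Fintype.piFinset_univ]
  simp only [Finset.prod_mul_distrib]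

theorem tensorOp_mulVec_prod (A : Fin (d + 1) → Matrix (Fin (2 ^ m)) (Fin (2 ^ m)) ℂ)
    (f : Fin (d + 1) → Fin (2 ^ m) → ℂ) :
    (tensorOp A).mulVec (fun j => ∏ r, f r (j r)) = fun j => ∏ r, ((A r).mulVec (f r)) (j r) := by
  ext j
  simp only [tensorOp, Matrix.mulVec, dotProduct, Matrix.of_apply]
  rw [Finset.prod_univ_sum, Fintype.piFinset_univ]
  simp only [Finset.prod_mul_distrib]

theorem tensorOp_diagonal (v : Fin (d + 1) → Fin (2 ^ m) → ℂ) :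
    tensorOp (fun r => Matrix.diagonal (v r)) = Matrix.diagonal fun g => ∏ r, v r (g r) := by
  ext j l
  simp only [tensorOp, Matrix.of_apply, Matrix.diagonal_apply]
  split_ifs with h
  · subst h; simp
  · obtain ⟨r, hr⟩ := Function.ne_iff.mp h
    exact Finset.prod_eq_zero (Finset.mem_univ r) (if_neg hr)

/-- The matrix is a transposed Vandermonde matrix whose nodes `exp (2πi (l - M / 2) / M)` are
distinct, as two indices differ by less than `M`. -/
theorem isUnit_det_Phi {a b : ℝ} (hab : a ≠ b) (m : ℕ) : IsUnit (Phi a b m).det := by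
  have h : Phi a b m = (Matrix.vandermonde fun l : Fin (2 ^ m) =>
      exp (I * ((2 * Real.pi * (((l : ℕ) : ℝ) - 2 ^ m / 2) / 2 ^ m : ℝ) : ℂ)))ᵀ := by
    ext j l
    rw [Phi_apply hab, Matrix.transpose_apply, Matrix.vandermonde_apply, ← Complex.exp_nat_mul]
    congr 1
    push_cast
    ring
  rw [h, Matrix.det_transpose, isUnit_iff_ne_zero, Matrix.det_vandermonde_ne_zero_iff]
  intro l l' hl
  obtain ⟨n, hn⟩ := Complex.exp_eq_exp_iff_exists_int.mp hl
  have h2 : ((2 * Real.pi * (((l : ℕ) : ℝ) - 2 ^ m / 2) / 2 ^ m : ℝ) : ℂ) =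
      ((2 * Real.pi * (((l' : ℕ) : ℝ) - 2 ^ m / 2) / 2 ^ m + n * (2 * Real.pi) : ℝ) : ℂ) := by
    apply mul_left_cancel₀ I_ne_zero
    rw [hn]
    push_cast
    ring
  have h3 := Complex.ofReal_injective h2
  have h4 : ((l : ℕ) : ℝ) = ((l' : ℕ) : ℝ) + n * 2 ^ m := by
    have := Real.pi_pos
    field_simp at h3
    linarith
  have h5 : ((l : ℕ) : ℤ) = ((l' : ℕ) : ℤ) + n * 2 ^ m := by exact_mod_cast h4
  have h6 : ((l : ℕ) : ℤ) < 2 ^ m := by exact_mod_cast l.2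
  have h7 : ((l' : ℕ) : ℤ) < 2 ^ m := by exact_mod_cast l'.2
  have h8 : n = 0 := by
    have : (0 : ℤ) < 2 ^ m := by positivity
    nlinarith
  apply Fin.ext
  simp only [h8, zero_mul, add_zero] at h5
  exact_mod_cast h5

theorem Pmu_mul_Phi {a b : ℝ} (hab : a ≠ b) (m : ℕ) :
    Pmu a b m * Phi a b m = Phi a b m * Dmu a b m := by
  rw [Pmu, Matrix.mul_assoc, Matrix.nonsing_inv_mul _ (isUnit_det_Phi hab m), Matrix.mul_one]

theorem Pmu_sq_mul_Phi {a b : ℝ} (hab : a ≠ b) (m : ℕ) :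
    Pmu a b m ^ 2 * Phi a b m = Phi a b m * Dmu a b m ^ 2 := by
  rw [pow_two, Matrix.mul_assoc, Pmu_mul_Phi hab, ← Matrix.mul_assoc, Pmu_mul_Phi hab,
    Matrix.mul_assoc, pow_two]

/-- Each tensor factor is intertwined by its own `Φ`: `P Φ = Φ D`, `P ^ 2 Φ = Φ D ^ 2`, or
trivially. -/
theorem hamP_mul_qft (d m : ℕ) : hamP d m * qft d m = qft d m * hamD d m := by
  rw [hamP, hamD, Finset.sum_mul, Finset.mul_sum]
  refine Finset.sum_congr rfl fun l _ => ?_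
  rw [qft, tensorOp_mul, tensorOp_mul]
  congr 1
  funext r
  split_ifs
  · rw [Matrix.mul_smul, Pmu_mul_Phi (lo_ne_hi r), Matrix.smul_mul]
  · rw [Matrix.mul_smul, Pmu_sq_mul_Phi (lo_ne_hi r), Matrix.smul_mul]
  · rw [Matrix.one_mul, Matrix.mul_one]

/-- The square of the momentum in the auxiliary direction, in position space. -/
noncomputable def auxSqP (d m : ℕ) : Matrix (Grid d m) (Grid d m) ℂ :=
  tensorOp fun r => if r = Fin.last d then Pmu (lo r) (hi r) m ^ 2 else 1

theorem auxSqP_mul_qft (d m : ℕ) : auxSqP d m * qft d m = qft d m *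
    Matrix.diagonal fun g => (waveNumber (-Real.pi) Real.pi m (g (Fin.last d)) : ℂ) ^ 2 := by
  have h : (Matrix.diagonal fun g : Grid d m =>
      (waveNumber (-Real.pi) Real.pi m (g (Fin.last d)) : ℂ) ^ 2) =
      tensorOp fun r => if r = Fin.last d then Dmu (lo r) (hi r) m ^ 2 else 1 := by
    have h1 : (fun r : Fin (d + 1) => if r = Fin.last d then Dmu (lo r) (hi r) m ^ 2 else 1) =
        fun r => Matrix.diagonal fun x =>
          if r = Fin.last d then (waveNumber (lo r) (hi r) m x : ℂ) ^ 2 else 1 := by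
      funext r
      split_ifs
      · rw [Dmu, Matrix.diagonal_pow]; rfl
      · exact Matrix.diagonal_one.symm
    rw [h1, tensorOp_diagonal]
    congr 1
    funext g
    simp [lo, hi]
  rw [h, auxSqP, qft, tensorOp_mul, tensorOp_mul]
  congr 1
  funext r
  split_ifs
  · rw [Matrix.mul_smul, Pmu_sq_mul_Phi (lo_ne_hi r), Matrix.smul_mul]
  · rw [Matrix.one_mul, Matrix.mul_one]

/-- The diagonal entries of the Hamiltonian in momentum space. -/
noncomputable def energy (d m : ℕ) (g : Grid d m) : ℝ :=
  (∑ l : Fin d, waveNumber (-1) 1 m (g (Fin.castSucc l))) *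
    waveNumber (-Real.pi) Real.pi m (g (Fin.last d)) ^ 2

theorem hamD_eq_diagonal (d m : ℕ) :
    hamD d m = Matrix.diagonal fun g => (energy d m g : ℂ) := by
  have h : ∀ l : Fin d, (tensorOp fun r =>
      if r = Fin.castSucc l then Dmu (lo r) (hi r) m
      else if r = Fin.last d then Dmu (lo r) (hi r) m ^ 2 else 1) =
      Matrix.diagonal fun g : Grid d m => (waveNumber (-1) 1 m (g (Fin.castSucc l)) : ℂ) *
        (waveNumber (-Real.pi) Real.pi m (g (Fin.last d)) : ℂ) ^ 2 := by
    intro l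
    have h1 : (fun r : Fin (d + 1) => if r = Fin.castSucc l then Dmu (lo r) (hi r) m
        else if r = Fin.last d then Dmu (lo r) (hi r) m ^ 2 else 1) =
        fun r => Matrix.diagonal fun x =>
          if r = Fin.castSucc l then (waveNumber (lo r) (hi r) m x : ℂ)
          else if r = Fin.last d then (waveNumber (lo r) (hi r) m x : ℂ) ^ 2 else 1 := by
      funext r
      split_ifs
      · rfl
      · rw [Dmu, Matrix.diagonal_pow]; rfl
      · exact Matrix.diagonal_one.symm
    rw [h1, tensorOp_diagonal]
    congr 1
    funext g
    have hl : Fin.last d ≠ Fin.castSucc l := (Fin.castSucc_lt_last l).ne'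
    rw [Fin.prod_univ_castSucc, if_neg hl, if_pos rfl]
    simp [lo, hi, (Fin.castSucc_lt_last _).ne]
  rw [hamD, Finset.sum_congr rfl fun l _ => h l]
  ext j g
  simp only [Matrix.sum_apply, Matrix.diagonal_apply, energy]
  split_ifs
  · push_cast
    rw [Finset.sum_mul]
  · simp

theorem diagEvolution_eq_diagonal (d m : ℕ) (t : ℝ) :
    diagEvolution d m t = Matrix.diagonal fun g => exp (-I * t * energy d m g) := by
  rw [diagEvolution, hamD_eq_diagonal, ← Matrix.diagonal_smul, Matrix.exp_diagonal]
  congr 1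
  funext g
  rw [Pi.coe_exp, Complex.exp_eq_exp_ℂ]
  rfl

/-- The integrating factor `exp (-c s)` makes the product constant; right derivatives suffice for
this. -/
theorem eq_exp_mul_of_hasDerivWithinAt {y : ℝ → ℂ} {c : ℂ}
    (hy : ∀ t : ℝ, 0 ≤ t → HasDerivWithinAt y (c * y t) (Set.Ici 0) t) {t : ℝ} (ht : 0 ≤ t) :
    y t = exp (c * t) * y 0 := by
  have hz : ∀ s : ℝ, 0 ≤ s →
      HasDerivWithinAt (fun s : ℝ => exp (-c * s) * y s) 0 (Set.Ici 0) s := by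
    intro s hs
    have h1 : HasDerivAt (fun s : ℝ => exp (-c * s)) (exp (-c * s) * (-c)) s := by
      have h2 : HasDerivAt (fun s : ℝ => -c * (s : ℂ)) (-c) s := by
        simpa using (Complex.ofRealCLM.hasDerivAt (x := s)).const_mul (-c)
      exact h2.cexp
    refine (h1.hasDerivWithinAt.mul (hy s hs)).congr_deriv ?_
    ring
  have hconst := constant_of_has_deriv_right_zero (a := 0) (b := t)
    (fun s hs => ((hz s hs.1).continuousWithinAt).mono Set.Icc_subset_Ici_self)
    (fun s hs => (hz s hs.1).mono (Set.Ici_subset_Ici.mpr hs.1)) t ⟨ht, le_rfl⟩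
  simp only [ofReal_zero, mul_zero, Complex.exp_zero, one_mul] at hconst
  rw [← hconst, ← mul_assoc, ← Complex.exp_add]
  simp

theorem qft_inv_mul (d : ℕ) (hm : 2 ≤ m) : (qft d m)⁻¹ * qft d m = 1 :=
  Matrix.nonsing_inv_mul _ ((Matrix.isUnit_iff_isUnit_det _).mp
    (Unitary.isUnit_coe (U := ⟨_, qft_mem_unitaryGroup d hm⟩)))

theorem qft_mul_inv (d : ℕ) (hm : 2 ≤ m) : qft d m * (qft d m)⁻¹ = 1 :=
  Matrix.mul_nonsing_inv _ ((Matrix.isUnit_iff_isUnit_det _).mp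
    (Unitary.isUnit_coe (U := ⟨_, qft_mem_unitaryGroup d hm⟩)))

theorem qft_inv_eq_conjTranspose (d : ℕ) (hm : 2 ≤ m) : (qft d m)⁻¹ = (qft d m)ᴴ :=
  Matrix.inv_eq_left_inv (Matrix.mem_unitaryGroup_iff'.mp (qft_mem_unitaryGroup d hm))

theorem qft_inv_mul_hamP (d : ℕ) (hm : 2 ≤ m) :
    (qft d m)⁻¹ * hamP d m = hamD d m * (qft d m)⁻¹ := by
  have h := congrArg (fun A => (qft d m)⁻¹ * A * (qft d m)⁻¹) (hamP_mul_qft d m)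
  simp only [Matrix.mul_assoc, qft_mul_inv d hm, Matrix.mul_one] at h
  rw [h, ← Matrix.mul_assoc, qft_inv_mul d hm, Matrix.one_mul]

theorem IsSchrodingerisedSolution.eq_evolution (hm : 2 ≤ m) {w : ℝ → Grid d m → ℂ}
    (hw : IsSchrodingerisedSolution d m w) {t : ℝ} (ht : 0 ≤ t) :
    w t = (qft d m * diagEvolution d m t * (qft d m)⁻¹).mulVec (w 0) := by
  have hy : ∀ g : Grid d m, ∀ s : ℝ, 0 ≤ s →
      HasDerivWithinAt (fun s => ((qft d m)⁻¹.mulVec (w s)) g)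
        ((-I * energy d m g) * ((qft d m)⁻¹.mulVec (w s)) g) (Set.Ici 0) s := by
    intro g s hs
    have h1 := ((((qft d m)⁻¹.mulVecLin).toContinuousLinearMap.restrictScalars ℝ).hasFDerivAt
      (x := w s)).comp_hasDerivWithinAt s (hw s hs)
    have h2 := (hasDerivWithinAt_pi.mp h1) g
    refine HasDerivWithinAt.congr_deriv h2 ?_
    change ((qft d m)⁻¹.mulVec (-(I • (hamP d m).mulVec (w s)))) g = _
    rw [Matrix.mulVec_neg, Matrix.mulVec_smul, Matrix.mulVec_mulVec, qft_inv_mul_hamP d hm,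
      ← Matrix.mulVec_mulVec, hamD_eq_diagonal, Pi.neg_apply, Pi.smul_apply,
      Matrix.mulVec_diagonal, smul_eq_mul]
    ring
  have h : (qft d m)⁻¹.mulVec (w t) = (diagEvolution d m t).mulVec ((qft d m)⁻¹.mulVec (w 0)) := by
    funext g
    rw [diagEvolution_eq_diagonal, Matrix.mulVec_diagonal,
      eq_exp_mul_of_hasDerivWithinAt (hy g) ht]
    ring_nf
  rw [← Matrix.mulVec_mulVec, ← Matrix.mulVec_mulVec, ← h, Matrix.mulVec_mulVec,
    qft_mul_inv d hm, Matrix.one_mulVec]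

end Spectral

/-! ### The sine factor, the convection equation and the diagonal circuit -/

section Convection

variable {d m : ℕ}

/-- The grid values of the sine function in the auxiliary direction. -/
noncomputable def sinVec (m : ℕ) : Fin (2 ^ m) → ℂ :=
  fun q => (Real.sin (node (-Real.pi) Real.pi m q) : ℂ)

/-- The momenta `±1` sit at the indices `M / 2 ± 1`; the upper one is below `M` only because `2 ≤
m`. -/
theorem exists_sinVec_coeff (hm : 2 ≤ m) : ∃ c : Fin (2 ^ m) → ℂ,
    (Phi (-Real.pi) Real.pi m).mulVec c = sinVec m ∧
    ∀ l, (waveNumber (-Real.pi) Real.pi m l : ℂ) ^ 2 * c l = c l := by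
  obtain ⟨n, rfl⟩ : ∃ n, m = n + 1 := ⟨m - 1, by omega⟩
  have hn : 2 ≤ 2 ^ n := by
    calc 2 = 2 ^ 1 := rfl
      _ ≤ 2 ^ n := Nat.pow_le_pow_right (by norm_num) (by omega)
  let a : Fin (2 ^ (n + 1)) := ⟨2 ^ n + 1, by rw [pow_succ]; omega⟩
  let b : Fin (2 ^ (n + 1)) := ⟨2 ^ n - 1, by rw [pow_succ]; omega⟩
  have ha : waveNumber (-Real.pi) Real.pi (n + 1) a = 1 := by
    simp only [waveNumber, a, pow_succ]
    push_cast
    field_simp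
    ring
  have hb : waveNumber (-Real.pi) Real.pi (n + 1) b = -1 := by
    simp only [waveNumber, b, pow_succ]
    rw [Nat.cast_sub (by omega)]
    push_cast
    field_simp
    ring
  -- The basis functions measure phases from `-π`, and `sin p = -sin (p + π)`, which fixes the
  -- signs.
  refine ⟨Pi.single a (I / 2) + Pi.single b (-(I / 2)), ?_, ?_⟩
  · funext q
    rw [Matrix.mulVec_add, Matrix.mulVec_single, Matrix.mulVec_single]
    simp only [Pi.add_apply, Pi.smul_apply, Matrix.col_apply, MulOpposite.smul_eq_mul_unop,
      MulOpposite.unop_op, Phi, Matrix.of_apply, specBasis, ha, hb, sinVec]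
    set p := node (-Real.pi) Real.pi (n + 1) q
    have : Real.sin p = -Real.sin (p - -Real.pi) := by
      rw [sub_neg_eq_add, Real.sin_add_pi, neg_neg]
    rw [this, ofReal_neg, ofReal_sin, Complex.sin]
    push_cast
    ring_nf
  · intro l
    simp only [Pi.add_apply, Pi.single_apply]
    by_cases h1 : l = a
    · rw [h1, ha]; simp
    · by_cases h2 : l = b
      · rw [h2, hb]; simp
      · simp [h1, h2]

theorem Pmu_sq_mulVec_sinVec (hm : 2 ≤ m) :
    (Pmu (-Real.pi) Real.pi m ^ 2).mulVec (sinVec m) = sinVec m := by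
  obtain ⟨c, hc, hc2⟩ := exists_sinVec_coeff hm
  rw [← hc, Matrix.mulVec_mulVec, Pmu_sq_mul_Phi (by linarith [Real.pi_pos] : -Real.pi ≠ Real.pi),
    ← Matrix.mulVec_mulVec, Dmu, Matrix.diagonal_pow]
  congr 1
  funext l
  rw [Matrix.mulVec_diagonal]
  exact hc2 l

theorem tensorOp_mulVec_sinLift_prod
    (A : Fin (d + 1) → Matrix (Fin (2 ^ m)) (Fin (2 ^ m)) ℂ) (f : Fin d → Fin (2 ^ m) → ℂ)
    (hA : (A (Fin.last d)).mulVec (sinVec m) = sinVec m) :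
    (tensorOp A).mulVec (sinLift fun j => ∏ i, f i (j i)) =
      sinLift fun j => ∏ i, ((A (Fin.castSucc i)).mulVec (f i)) (j i) := by
  have h : ∀ f : Fin d → Fin (2 ^ m) → ℂ, (sinLift fun j => ∏ i, f i (j i)) =
      fun j : Grid d m => ∏ r, (Fin.snoc (α := fun _ => Fin (2 ^ m) → ℂ) f (sinVec m) r) (j r) := by
    intro f
    funext j
    rw [Fin.prod_univ_castSucc]
    simp [sinLift, sinVec, mul_comm]
  rw [h, h, tensorOp_mulVec_prod]
  funext j
  rw [Fin.prod_univ_castSucc, Fin.prod_univ_castSucc]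
  simp [hA]

theorem sinLift_sum_smul {ι : Type*} (S : Finset ι) (c : ι → ℂ)
    (v : ι → (Fin d → Fin (2 ^ m)) → ℂ) :
    sinLift (fun j => ∑ i ∈ S, c i * v i j) = ∑ i ∈ S, c i • sinLift (v i) := by
  funext j
  simp only [sinLift, Finset.sum_apply, Pi.smul_apply, smul_eq_mul, Finset.mul_sum]
  exact Finset.sum_congr rfl fun i _ => by ring

theorem auxSqP_mulVec_sinLift (hm : 2 ≤ m) (u : (Fin d → Fin (2 ^ m)) → ℂ) :
    (auxSqP d m).mulVec (sinLift u) = sinLift u := by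
  -- Point masses are product functions, so linearity reduces arbitrary data to pure tensors.
  have hu : u = fun j => ∑ l, u l * ∏ i, (Pi.single (l i) 1 : Fin (2 ^ m) → ℂ) (j i) := by
    funext j
    rw [Finset.sum_eq_single j]
    · simp
    · intro l _ hl
      obtain ⟨i, hi⟩ := Function.ne_iff.mp hl
      rw [Finset.prod_eq_zero (Finset.mem_univ i), mul_zero]
      simp [hi.symm]
    · simp
  rw [hu, sinLift_sum_smul, Matrix.mulVec_sum]
  refine Finset.sum_congr rfl fun l _ => ?_
  rw [Matrix.mulVec_smul, auxSqP, tensorOp_mulVec_sinLift_prod]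
  · simp only [(Fin.castSucc_lt_last _).ne, if_false, Matrix.one_mulVec]
  · simpa [lo, hi] using Pmu_sq_mulVec_sinVec hm

/-- The Fourier coefficients of `sin (p) u` live on the momenta `±1` in the auxiliary variable. -/
theorem waveNumber_sq_mul_coeff (hm : 2 ≤ m) (u : (Fin d → Fin (2 ^ m)) → ℂ) (g : Grid d m) :
    (waveNumber (-Real.pi) Real.pi m (g (Fin.last d)) : ℂ) ^ 2 *
      ((qft d m)⁻¹.mulVec (sinLift u)) g = ((qft d m)⁻¹.mulVec (sinLift u)) g := by
  have h := congrArg (fun A => (qft d m)⁻¹ * A * (qft d m)⁻¹) (auxSqP_mul_qft d m)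
  simp only [Matrix.mul_assoc, qft_mul_inv d hm, Matrix.mul_one] at h
  rw [← Matrix.mul_assoc (qft d m)⁻¹ (qft d m), qft_inv_mul d hm, Matrix.one_mul] at h
  rw [← Matrix.mulVec_diagonal (fun g : Grid d m =>
    (waveNumber (-Real.pi) Real.pi m (g (Fin.last d)) : ℂ) ^ 2), Matrix.mulVec_mulVec, ← h,
    ← Matrix.mulVec_mulVec, auxSqP_mulVec_sinLift hm]

/-- The grid values of `∏ φ_{l_i}(x_i)`. -/
noncomputable def modeVec (l : Fin d → Fin (2 ^ m)) : (Fin d → Fin (2 ^ m)) → ℂ :=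
  fun j => ∏ i, Phi (-1) 1 m (j i) (l i)

theorem Pmu_mulVec_col {a b : ℝ} (hab : a ≠ b) (l : Fin (2 ^ m)) :
    (Pmu a b m).mulVec (fun j => Phi a b m j l) =
      fun j => (waveNumber a b m l : ℂ) * Phi a b m j l := by
  funext j
  have h := congrFun (congrFun (Pmu_mul_Phi hab m) j) l
  rw [Dmu, Matrix.mul_diagonal, mul_comm (Phi a b m j l)] at h
  exact h

/-- `P_μ ^ 2` fixes the sine factor, so each summand acts on the mode only by the wave number of its
own direction. -/
theorem hamP_mulVec_modeVec (hm : 2 ≤ m) (l : Fin d → Fin (2 ^ m)) :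
    (hamP d m).mulVec (sinLift (modeVec l)) =
      ((∑ i, waveNumber (-1) 1 m (l i) : ℝ) : ℂ) • sinLift (modeVec l) := by
  rw [hamP, Matrix.sum_mulVec, ofReal_sum, Finset.sum_smul]
  refine Finset.sum_congr rfl fun i _ => ?_
  have hl : Fin.last d ≠ Fin.castSucc i := (Fin.castSucc_lt_last i).ne'
  unfold modeVec
  rw [tensorOp_mulVec_sinLift_prod _ (fun k x => Phi (-1) 1 m x (l k))]
  · have h : ∀ j : Fin d → Fin (2 ^ m), (∏ k, ((if Fin.castSucc k = Fin.castSucc i then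
        Pmu (lo (Fin.castSucc k)) (hi (Fin.castSucc k)) m
        else if Fin.castSucc k = Fin.last d then
          Pmu (lo (Fin.castSucc k)) (hi (Fin.castSucc k)) m ^ 2
        else 1).mulVec fun x => Phi (-1) 1 m x (l k)) (j k)) =
        (waveNumber (-1) 1 m (l i) : ℂ) * ∏ k, Phi (-1) 1 m (j k) (l k) := by
      intro j
      rw [← Finset.mul_prod_erase _ _ (Finset.mem_univ i),
        ← Finset.mul_prod_erase Finset.univ (fun k => Phi (-1) 1 m (j k) (l k))
          (Finset.mem_univ i), ← mul_assoc]
      congr 1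
      · rw [if_pos rfl]
        simp only [lo, hi, (Fin.castSucc_lt_last _).ne, if_false]
        rw [Pmu_mulVec_col (by norm_num)]
      · refine Finset.prod_congr rfl fun k hk => ?_
        have hk' : Fin.castSucc k ≠ Fin.castSucc i :=
          fun h => (Finset.ne_of_mem_erase hk) (Fin.castSucc_injective _ h)
        rw [if_neg hk', if_neg (Fin.castSucc_lt_last _).ne, Matrix.one_mulVec]
    funext j
    simp only [sinLift, h, Pi.smul_apply, smul_eq_mul]
    ring
  · rw [if_neg hl, if_pos rfl]
    simpa [lo, hi] using Pmu_sq_mulVec_sinVec hm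

theorem isSchrodingerisedSolution_modes (hm : 2 ≤ m) (c : (Fin d → Fin (2 ^ m)) → ℂ) :
    IsSchrodingerisedSolution d m fun t => sinLift fun j =>
      ∑ l, (c l * exp (-I * ((∑ i, waveNumber (-1) 1 m (l i) : ℝ) : ℂ) * t)) * modeVec l j := by
  intro t _
  simp only [sinLift_sum_smul]
  have h : ∀ l : Fin d → Fin (2 ^ m), HasDerivAt (fun t : ℝ =>
      (c l * exp (-I * ((∑ i, waveNumber (-1) 1 m (l i) : ℝ) : ℂ) * t)) •
        (sinLift (modeVec l) : Grid d m → ℂ))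
      ((c l * (exp (-I * ((∑ i, waveNumber (-1) 1 m (l i) : ℝ) : ℂ) * t) *
        (-I * ((∑ i, waveNumber (-1) 1 m (l i) : ℝ) : ℂ)))) • sinLift (modeVec l)) t := by
    intro l
    set σ := ((∑ i, waveNumber (-1) 1 m (l i) : ℝ) : ℂ)
    have h1 : HasDerivAt (fun t : ℝ => -I * σ * (t : ℂ)) (-I * σ) t := by
      simpa using (Complex.ofRealCLM.hasDerivAt (x := t)).const_mul (-I * σ)
    exact (h1.cexp.const_mul (c l)).smul_const _
  have h2 := (HasDerivAt.fun_sum fun l (_ : l ∈ Finset.univ) => h l).hasDerivWithinAt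
    (s := Set.Ici 0)
  refine h2.congr_deriv ?_
  rw [Matrix.mulVec_sum, Finset.smul_sum, ← Finset.sum_neg_distrib]
  refine Finset.sum_congr rfl fun l _ => ?_
  rw [Matrix.mulVec_smul, hamP_mulVec_modeVec hm, smul_smul, smul_smul, ← neg_smul]
  congr 1
  ring

/-- Classical solutions of the convection equation are constant along characteristics. -/
theorem IsConvectionSolution.eq_initial {u : ℝ → (Fin d → ℝ) → ℂ}
    (hu : IsConvectionSolution d u) {t : ℝ} (ht : 0 ≤ t) (x : Fin d → ℝ) :
    u t x = u 0 fun i => x i - t := by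
  obtain ⟨hdiff, -, heq⟩ := hu
  let y : ℝ → Fin d → ℝ := fun s i => x i - t + s
  have hd : ∀ s : ℝ, 0 ≤ s → HasDerivWithinAt (fun s => u s (y s)) 0 (Set.Ici 0) s := by
    intro s hs
    have hF := (hdiff (s, y s) (Set.mk_mem_prod (Set.mem_Ici.mpr hs) (Set.mem_univ _))).hasFDerivWithinAt
    set F := fderivWithin ℝ (fun y : ℝ × (Fin d → ℝ) => u y.1 y.2)
      (Set.Ici 0 ×ˢ Set.univ) (s, y s)
    -- Differentiability is only given for nonnegative times. One chain rule for curves staying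
    -- there serves the characteristic, the time axis and the coordinate lines.
    have hcurve : ∀ {γ : ℝ → ℝ × (Fin d → ℝ)} {γ' : ℝ × (Fin d → ℝ)} {T : Set ℝ} {r : ℝ},
        HasDerivWithinAt γ γ' T r → γ r = (s, y s) → (∀ r ∈ T, 0 ≤ (γ r).1) →
        HasDerivWithinAt (fun r => u (γ r).1 (γ r).2) (F γ') T r := by
      intro γ γ' T r hγ hr hT
      rw [← hr] at hF
      exact hF.comp_hasDerivWithinAt r hγ fun r' hr' =>
        Set.mk_mem_prod (Set.mem_Ici.mpr (hT r' hr')) (Set.mem_univ _)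
    have h1 : HasDerivWithinAt (fun s => u s (y s)) (F (1, fun _ => 1)) (Set.Ici 0) s :=
      hcurve (γ := fun s => (s, y s)) ((hasDerivWithinAt_id s _).prodMk
        (hasDerivWithinAt_pi.mpr fun i =>
          ((hasDerivAt_id s).const_add (x i - t)).hasDerivWithinAt)) rfl fun r hr => hr
    have h2 : HasDerivWithinAt (fun r => u r (y s)) (F (1, 0)) (Set.Ici 0) s :=
      hcurve (γ := fun r => (r, y s)) ((hasDerivWithinAt_id s _).prodMk
        (hasDerivWithinAt_const _ _ _)) rfl fun r hr => hr
    have h3 : ∀ l : Fin d, HasDerivAt (fun r => u s (Function.update (y s) l r))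
        (F (0, Pi.single l 1)) (y s l) := fun l =>
      hasDerivWithinAt_univ.mp (hcurve (γ := fun r => (s, Function.update (y s) l r))
        (((hasDerivAt_const _ _).prodMk (hasDerivAt_update _ _ _)).hasDerivWithinAt)
        (by simp) fun _ _ => hs)
    have h4 := heq s hs (y s)
    rw [h2.derivWithin (uniqueDiffOn_Ici 0 s hs),
      Finset.sum_congr rfl fun l _ => (h3 l).deriv, ← map_sum, ← map_add] at h4
    -- The equation is the vanishing of the derivative in the direction `(1, 1, …, 1)`, the tangent
    -- of the characteristic.
    have h5 : ((1 : ℝ), (0 : Fin d → ℝ)) + ∑ l : Fin d, ((0 : ℝ), (Pi.single l 1 : Fin d → ℝ)) =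
        (1, fun _ => 1) := by
      ext i
      · simp [Prod.fst_sum]
      · simp [Prod.snd_sum, Finset.sum_apply, Pi.single_apply]
    rw [h5] at h4
    rwa [h4] at h1
  have hconst := constant_of_has_deriv_right_zero (a := 0) (b := t)
    (fun s hs => ((hd s hs.1).continuousWithinAt).mono Set.Icc_subset_Ici_self)
    (fun s hs => (hd s hs.1).mono (Set.Ici_subset_Ici.mpr hs.1)) t ⟨ht, le_rfl⟩
  simpa [y] using hconst

theorem specBasis_sub (a b : ℝ) (m : ℕ) (l : Fin (2 ^ m)) (x t : ℝ) :
    specBasis a b m l (x - t) = exp (-I * waveNumber a b m l * t) * specBasis a b m l x := by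
  rw [specBasis, specBasis, ← Complex.exp_add]
  congr 1
  push_cast
  ring

/-- The spectral discretisation of `sin (p) u` is exact for trigonometric polynomials. -/
theorem IsSchrodingerisedSolution.eq_sinLift (hm : 2 ≤ m) {w : ℝ → Grid d m → ℂ}
    (hw : IsSchrodingerisedSolution d m w) {u : ℝ → (Fin d → ℝ) → ℂ}
    (hu : IsConvectionSolution d u) (hspec : InSpectralSpace d m (u 0))
    (h0 : w 0 = sinLift fun j => u 0 (xPoint d m j)) {t : ℝ} (ht : 0 ≤ t) :
    w t = sinLift fun j => u t (xPoint d m j) := by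
  obtain ⟨c, hc⟩ := hspec
  have hut : ∀ s : ℝ, 0 ≤ s → ∀ j, u s (xPoint d m j) =
      ∑ l, (c l * exp (-I * ((∑ i, waveNumber (-1) 1 m (l i) : ℝ) : ℂ) * s)) * modeVec l j := by
    intro s hs j
    rw [hu.eq_initial hs, hc]
    refine Finset.sum_congr rfl fun l _ => ?_
    simp only [specBasis_sub]
    rw [Finset.prod_mul_distrib, ← Complex.exp_sum, ← Finset.sum_mul, ← Finset.mul_sum,
      ← ofReal_sum, ← mul_assoc]
    rfl
  have h1 := (isSchrodingerisedSolution_modes hm c).eq_evolution hm ht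
  simp only [← hut t ht, ← hut 0 le_rfl] at h1
  -- Uniqueness: both solutions are given by the same evolution of the same initial value.
  rw [hw.eq_evolution hm ht, h0, h1]

/-- The diagonal circuit: since `μ ^ 2 = 1` on the support of the data, one-qubit phase gates
suffice. -/
theorem exists_circuit_diagonal_evolution (d : ℕ) (hm : 2 ≤ m) (t : ℝ) :
    ∃ C : Circuit (Qubits d m), C.length ≤ (d + 1) * m ∧ circuitOp C = Matrix.diagonal fun g =>
      exp (-I * t * ((∑ l : Fin d, waveNumber (-1) 1 m (g (Fin.castSucc l)) : ℝ) : ℂ)) := by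
  have := nontrivial_qubits d hm
  -- A wave number is affine in the bits of its index. Its constant part `M / 2` is shared equally
  -- among the `m` qubits, which explains the division by `m`.
  obtain ⟨C, hC, hCm⟩ := exists_circuit_diagonal_sum (Q := Qubits d m)
    fun q x => if q.1 = Fin.last d then 0 else
      -t * (Real.pi * (((x : ℕ) : ℝ) * 2 ^ (q.2 : ℕ) - 2 ^ m / 2 / m))
  refine ⟨C, hC.trans_eq (by simp), ?_⟩
  rw [circuitOp, hCm, Matrix.reindex_apply, Matrix.submatrix_diagonal_equiv]
  congr 1
  funext g
  obtain ⟨s, rfl⟩ := (gridEquiv d m).surjective g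
  rw [Function.comp_apply, Equiv.symm_apply_apply, Fintype.sum_prod_type,
    Fin.sum_univ_castSucc]
  have hm0 : (m : ℝ) ≠ 0 := by exact_mod_cast (by omega : m ≠ 0)
  have h : ∀ l : Fin d, waveNumber (-1) 1 m (gridEquiv d m s (Fin.castSucc l)) =
      ∑ i, Real.pi * (((s (Fin.castSucc l, i) : ℕ) : ℝ) * 2 ^ (i : ℕ) - 2 ^ m / 2 / m) := by
    intro l
    have h1 : ((gridEquiv d m s (Fin.castSucc l) : ℕ) : ℝ) =
        ∑ i, ((s (Fin.castSucc l, i) : ℕ) : ℝ) * 2 ^ (i : ℕ) := by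
      have : (gridEquiv d m s (Fin.castSucc l) : ℕ) = _ :=
        finFunctionFinEquiv_apply fun i => s (Fin.castSucc l, i)
      rw [this]
      push_cast
      rfl
    rw [waveNumber, h1, ← Finset.mul_sum, Finset.sum_sub_distrib, Finset.sum_const,
      Finset.card_univ, Fintype.card_fin, nsmul_eq_mul]
    field_simp
    ring
  simp only [h, (Fin.castSucc_lt_last _).ne, if_false, if_true, Finset.sum_const_zero, add_zero,
    ← Finset.mul_sum]
  congr 1
  push_cast
  ring

end Convection

end

/-! ### Assembly of the circuit and the error estimate -/

open Matrix in
open scoped Matrix.Norms.L2Operator in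
theorem norm_mul_mul_sub_mul_mul_le {n : Type*} [Fintype n] [DecidableEq n]
    {A A' B C C' : Matrix n n ℂ} (hA' : A' ∈ Matrix.unitaryGroup n ℂ)
    (hB : B ∈ Matrix.unitaryGroup n ℂ) (hC : C ∈ Matrix.unitaryGroup n ℂ) :
    ‖A * B * C - A' * B * C'‖ ≤ ‖A - A'‖ + ‖C - C'‖ := by
  refine (norm_mul_sub_mul_le (mul_mem hA' hB) hC).trans_eq ?_
  rw [← sub_mul, CStarRing.norm_mul_mem_unitary _ hB]

theorem stateNorm_mulVec_le {d m : ℕ} (A : Matrix (Grid d m) (Grid d m) ℂ) (v : Grid d m → ℂ) :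
    stateNorm (A.mulVec v) ≤ opNorm A * stateNorm v :=
  (Matrix.toEuclideanCLM (n := Grid d m) (𝕜 := ℂ) A).le_opNorm (WithLp.toLp 2 v)

theorem opNorm_conjTranspose {d m : ℕ} (A : Matrix (Grid d m) (Grid d m) ℂ) :
    opNorm A.conjTranspose = opNorm A :=
  Matrix.l2_opNorm_conjTranspose A

theorem theorem2p2 (k : ℕ) :
    ∃ K : ℝ, 0 < K ∧ ∀ d m : ℕ, 1 ≤ d → 2 ≤ m → ∀ t : ℝ, 0 ≤ t →
      ∃ Cin Cdiag Cout : Circuit (Qubits d m),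
        -- the gate count of the whole circuit
        ((Cin ++ Cdiag ++ Cout).length : ℝ) ≤ K * ((d + 1) * m * Real.log m) ∧
        -- an inverse QFT, a diagonal unitary, a QFT
        opNorm (circuitOp Cin - (qft d m)⁻¹) ≤ (d + 1) / (m : ℝ) ^ k ∧
        (circuitOp Cdiag).IsDiag ∧
        opNorm (circuitOp Cout - qft d m) ≤ (d + 1) / (m : ℝ) ^ k ∧
        -- the momentum variables diagonalise the Schrödingerised system
        (∀ w : ℝ → Grid d m → ℂ, IsSchrodingerisedSolution d m w →
          w t = (qft d m * diagEvolution d m t * (qft d m)⁻¹).mulVec (w 0)) ∧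
        -- simulation of the solution with initial value `w = sin (p) u`
        ∀ (u₀ : (Fin d → Fin (2 ^ m)) → ℂ) (w : ℝ → Grid d m → ℂ),
          IsSchrodingerisedSolution d m w → w 0 = sinLift u₀ →
            (circuitOp Cdiag).mulVec ((qft d m)⁻¹.mulVec (w 0)) =
              (diagEvolution d m t).mulVec ((qft d m)⁻¹.mulVec (w 0)) ∧
            stateNorm ((circuitOp (Cin ++ Cdiag ++ Cout)).mulVec (w 0) - w t) ≤
              (d + 1) / (m : ℝ) ^ k * stateNorm (w 0) ∧
            -- it consists of grid values of `sin (p) u` for the solution `u` of the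
            -- convection equation whose initial value is the Fourier interpolant of `u₀`
            ∀ u : ℝ → (Fin d → ℝ) → ℂ, IsConvectionSolution d u →
              InSpectralSpace d m (u 0) → (∀ j, u₀ j = u 0 (xPoint d m j)) →
                w t = sinLift (fun j => u t (xPoint d m j)) := by
  -- Two Fourier circuits at exponent `k + 1` give `2 * (3 * (k + 1) + 12) = 6 * k + 30`; the
  -- diagonal part adds `2` since `1 ≤ 2 log m`.
  refine ⟨6 * k + 32, by positivity, fun d m _ hm t ht => ?_⟩
  -- The errors of the two transforms add; the resulting factor `2 ≤ m` is absorbed by one extra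
  -- power of `m`.
  obtain ⟨C, hC, hCn⟩ := exists_circuit_qft_log d (k + 1) hm
  obtain ⟨D, hD, hDm⟩ := exists_circuit_diagonal_evolution d hm t
  have hm2 : (2 : ℝ) ≤ m := by exact_mod_cast hm
  have hpow : 2 * ((d + 1) / (m : ℝ) ^ (k + 1)) ≤ (d + 1) / (m : ℝ) ^ k := by
    rw [pow_succ, ← div_div, mul_div_assoc', div_le_iff₀ (by positivity), mul_comm]
    gcongr
  have hin : opNorm (circuitOp (Circuit.inverse C) - (qft d m)⁻¹) ≤ (d + 1) / (m : ℝ) ^ (k + 1) := by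
    rw [circuitOp_inverse, qft_inv_eq_conjTranspose d hm, ← Matrix.conjTranspose_sub,
      opNorm_conjTranspose]
    exact hCn
  have hpos : (0 : ℝ) ≤ (d + 1) / (m : ℝ) ^ (k + 1) := by positivity
  refine ⟨Circuit.inverse C, D, C, ?_, by linarith, ?_, by linarith,
    fun w hw => hw.eq_evolution hm ht, fun u₀ w hw h0 => ?_⟩
  · rw [List.length_append, List.length_append, Circuit.length_inverse]
    have hD' : (D.length : ℝ) ≤ (d + 1) * m := by exact_mod_cast hD
    have h2 := (clog_le_log hm).2
    have h3 : ((d : ℝ) + 1) * m * 1 ≤ (d + 1) * m * (2 * Real.log m) := by gcongr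
    push_cast at hC ⊢
    nlinarith
  · rw [hDm]
    exact Matrix.isDiag_diagonal _
  have hdiag : (circuitOp D).mulVec ((qft d m)⁻¹.mulVec (w 0)) =
      (diagEvolution d m t).mulVec ((qft d m)⁻¹.mulVec (w 0)) := by
    funext g
    rw [h0, hDm, diagEvolution_eq_diagonal, Matrix.mulVec_diagonal, Matrix.mulVec_diagonal]
    -- Where a coefficient vanishes the phase is irrelevant; elsewhere `μ_p ^ 2 = 1` and the two
    -- phases coincide.
    by_cases hg : ((qft d m)⁻¹.mulVec (sinLift u₀)) g = 0
    · rw [hg, mul_zero, mul_zero]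
    · have h1 := mul_right_cancel₀ hg
        ((waveNumber_sq_mul_coeff hm u₀ g).trans (one_mul _).symm)
      rw [energy, Complex.ofReal_mul, Complex.ofReal_pow, h1, mul_one]
  refine ⟨hdiag, ?_, fun u hu hspec hu₀ => hw.eq_sinLift hm hu hspec ?_ ht⟩
  -- With the diagonal circuit in place of the true evolution, only the Fourier parts differ from
  -- the implemented operator.
  · have hwt : w t = (qft d m * circuitOp D * (qft d m)⁻¹).mulVec (w 0) := by
      rw [hw.eq_evolution hm ht, ← Matrix.mulVec_mulVec, ← Matrix.mulVec_mulVec, ← hdiag,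
        Matrix.mulVec_mulVec, Matrix.mulVec_mulVec]
    rw [hwt, circuitOp_append, circuitOp_append, ← Matrix.mul_assoc, ← Matrix.sub_mulVec]
    refine (stateNorm_mulVec_le _ _).trans (mul_le_mul_of_nonneg_right ?_ (norm_nonneg _))
    have h := norm_mul_mul_sub_mul_mul_le (A := circuitOp C) (C' := (qft d m)⁻¹)
      (qft_mem_unitaryGroup d hm) (circuitOp_mem_unitaryGroup D)
      (circuitOp_mem_unitaryGroup (Circuit.inverse C))
    exact h.trans (by simp only [← opNorm_eq]; linarith)
  · rw [h0]
    exact congrArg sinLift (funext hu₀)
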